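/- For an integer $b\ge 2$ and an integer $0\le x<b^4$, written with exactly four base-$b$ digits (leading zeros allowed), let $K_b(x)=D-A$, where $D$ and $A$ are the integers whose four base-$b$ digits are those of $x$ arranged in descending and in ascending order, respectively. For $b\in\{2,4\}\cup\{5,10,15,20,\dots\}$ consider those $x$ with $0\le x<b^4$ for which some iterate $K_b^t(x)$, $t\ge 0$, is a nonzero fixed point of $K_b$; the least such $t$ is the distance of $x$ from a nonzero fixed point. Let $M_b$ be the largest of these finite distances. Then $M_b$ exists and: (i) $M_2=1$, $M_4=3$, $M_5=4$, $M_{10}=7$ and $M_{20}=10$. (ii) If $b=5m\cdot 2^n$ with $m>1$ odd and $n\ge 0$, then $M_b=n+2$. (iii) If $b=5\cdot 2^n$ with $n\ge 3$, then \[ M_b=\begin{cases}4n+6 & n\equiv 0 \pmod 4,\\ 3n+5 & n\equiv 1 \pmod 4,\\ 3n+5 & n\equiv 2 \pmod 4,\\ 5n+6 & n\equiv 3 \pmod 4.\end{cases} \] -/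

import Mathlib

/-- The four base-`b` digits of `x` (leading zeros included), least significant first. -/
def fourDigits (b x : ℕ) : List ℕ :=
  [x % b, x / b % b, x / b ^ 2 % b, x / b ^ 3 % b]

/-- The four-digit Kaprekar map in base `b`: the digits of `x` in descending order, read as a
base-`b` numeral, minus the digits of `x` in ascending order, read as a base-`b` numeral.
`Nat.ofDigits` puts the least significant digit first, so a list sorted by `≤` is the numeral
with descending digits. The minuend is never smaller than the subtrahend, so the subtraction
does not truncate. -/
def kaprekar (b x : ℕ) : ℕ :=
  Nat.ofDigits b ((fourDigits b x).insertionSort (· ≤ ·)) -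
    Nat.ofDigits b ((fourDigits b x).insertionSort (· ≥ ·))

/-- `y` is a nonzero fixed point of the Kaprekar map in base `b`. -/
def IsNonzeroFixedPoint (b y : ℕ) : Prop :=
  y ≠ 0 ∧ Function.IsFixedPt (kaprekar b) y

/-- `x` is at finite distance `t` from a nonzero fixed point: `t` is the least number of
iterations of the Kaprekar map in base `b` that takes `x` to a nonzero fixed point. -/
def HasDistance (b x t : ℕ) : Prop :=
  IsLeast {s : ℕ | IsNonzeroFixedPoint b ((kaprekar b)^[s] x)} t

/-- `M` is the largest finite distance of a four-digit base-`b` number `x`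
(that is, `0 ≤ x < b ^ 4`) from a nonzero fixed point. -/
def IsMaxDistance (b M : ℕ) : Prop :=
  IsGreatest {t : ℕ | ∃ x < b ^ 4, HasDistance b x t} M

/-!
After one application, the orbit of a numeral under the Kaprekar map is determined by the unordered
pair of the outer and inner differences of its sorted digits. Such a pair evolves by folding each
entry, `x ↦ |b - 2 * x|`, except when an entry is `0` (complement) or when both entries fold to
the same number (collision). The only nonzero fixed pair in base `5 * k` is `{3 * k, k}`.

If `b = 5 * m * 2 ^ n` with `m > 1` odd, a pair produced by a complement or a collision is never
divisible by `m`, whereas the nonzero fixed pair is, so a terminating orbit consists of folds only.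

In base `5 * 2 ^ n`, `n + 1` folds send `x` to `2 ^ n`, `3 * 2 ^ n` or `5 * 2 ^ n` according to `x`
modulo `5`. Hence a pair with nonzero residues `y ≡ ±2 * x` terminates after `n + 1` steps, and any
other terminating orbit passes through a complement or a collision and from there, unless it then
terminates directly, through one of three critical pairs. The fate of these depends only on `2 ^ n`
modulo `5`, that is, on `n` modulo `4`. The slowest orbits traverse the longest chain of critical
pairs; they start next to half the base (`n ≡ 0, 1`), next to a quarter of the base (`n ≡ 2`) or
at `{1, 4}` (`n ≡ 3`).
-/

section ReachesWithin

variable {α : Type*} {f : α → α} {P : α → Prop} {x : α} {t : ℕ}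

/-- Whenever the orbit of `x` under `f` meets `P`, it satisfies `P` at time `t`. This does not
assert that `P` is ever met: for a property `P` of fixed points of `f` it says that the orbit
enters `P` at some time `≤ t` or never. -/
def ReachesWithin (f : α → α) (P : α → Prop) (x : α) (t : ℕ) : Prop :=
  ∀ j, P (f^[j] x) → P (f^[t] x)

theorem iterate_of_forall_fixed (hP : ∀ y, P y → f y = y) {j : ℕ} (h : P (f^[j] x)) (hj : j ≤ t) :
    P (f^[t] x) := by
  rwa [← Nat.sub_add_cancel hj, Function.iterate_add_apply, Function.iterate_fixed (hP _ h)]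

theorem ReachesWithin.mono {t' : ℕ} (hP : ∀ y, P y → f y = y) (h : ReachesWithin f P x t)
    (ht : t ≤ t') : ReachesWithin f P x t' :=
  fun j hj => iterate_of_forall_fixed hP (h j hj) ht

theorem ReachesWithin.of_iterate (hP : ∀ y, P y → f y = y) {d : ℕ}
    (h : ReachesWithin f P (f^[d] x) t) : ReachesWithin f P x (t + d) := by
  intro j hj
  rw [Function.iterate_add_apply]
  apply h j
  rw [← Function.iterate_add_apply]
  exact iterate_of_forall_fixed hP hj (Nat.le_add_right j d)

theorem reachesWithin_of_iterate_add_eq {d : ℕ} (hP : ∀ y, P y → f y = y) (hd : 0 < d)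
    (h : f^[d + t] x = f^[t] x) : ReachesWithin f P x t := by
  intro j hj
  have hcycle : f^[d * j + t] x = f^[t] x := by
    rw [Function.iterate_add_apply] at h ⊢
    rw [Function.iterate_mul]
    exact Function.iterate_fixed h j
  rw [← hcycle]
  exact iterate_of_forall_fixed hP hj ((Nat.le_mul_of_pos_left j hd).trans (Nat.le_add_right _ _))

end ReachesWithin

/-! ### Pairs of digit differences -/

/-- Inverted tent map `x ↦ |b - 2 * x|`, by which the Kaprekar map acts on a generic digit
difference. -/
def fold (b x : ℕ) : ℕ := Nat.dist b (2 * x)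

/-- Digit differences of the successor of a numeral with digit differences `w` and `0`. -/
def complementPair (b w : ℕ) : Sym2 ℕ := s(b - w, w - 1)

/-- Digit differences of the successor of a numeral whose digit differences both fold to `u`.
The second entry is `|u - 1|`. -/
def collisionPair (u : ℕ) : Sym2 ℕ := s(u + 1, Nat.dist u 1)

/-- The Kaprekar map on unordered pairs of digit differences. -/
def step (b : ℕ) (p : Sym2 ℕ) : Sym2 ℕ :=
  if p = s(0, 0) then p
  else if 0 ∈ p then complementPair b p.sup
  else if (p.map (fold b)).IsDiag then collisionPair (p.map (fold b)).sup
  else p.map (fold b)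

/-- Value of the Kaprekar map at a numeral with the given pair of digit differences. -/
def pairValue (b : ℕ) (p : Sym2 ℕ) : ℕ := p.sup * (b ^ 3 - 1) + p.inf * (b ^ 2 - b)

/-- Outer and inner difference of an increasing list of four numbers. -/
def outerInner : List ℕ → Sym2 ℕ
  | [p, q, r, t] => s(t - p, r - q)
  | _ => s(0, 0)

/-- Outer and inner difference of the sorted base-`b` digits of `x`. -/
def digitDiffs (b x : ℕ) : Sym2 ℕ := outerInner ((fourDigits b x).insertionSort (· ≤ ·))

/-- Pairs of digit differences that correspond to nonzero fixed points of the Kaprekar map. -/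
def IsNonzeroFixedPair (b : ℕ) (p : Sym2 ℕ) : Prop := p ≠ s(0, 0) ∧ step b p = p

theorem step_zero_zero (b : ℕ) : step b s(0, 0) = s(0, 0) := if_pos rfl

theorem step_zero_right {b w : ℕ} (hw : 0 < w) : step b s(w, 0) = complementPair b w := by
  simp [step, hw.ne']

theorem step_eq_collisionPair {b x y : ℕ} (hx : 0 < x) (hy : 0 < y) (h : fold b x = fold b y) :
    step b s(x, y) = collisionPair (fold b x) := by
  simp [step, hx.ne, hy.ne, hx.ne', h]

theorem step_eq_map {b x y : ℕ} (hx : 0 < x) (hy : 0 < y) (h : fold b x ≠ fold b y) :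
    step b s(x, y) = s(fold b x, fold b y) := by
  simp [step, hx.ne, hy.ne, hx.ne', h]

theorem exists_sorted_fourDigits {b : ℕ} (hb : 0 < b) (x : ℕ) :
    ∃ p q r t : ℕ, p ≤ q ∧ q ≤ r ∧ r ≤ t ∧ t < b ∧
      (fourDigits b x).insertionSort (· ≤ ·) = [p, q, r, t] ∧
      (fourDigits b x).insertionSort (· ≥ ·) = [t, r, q, p] := by
  have hperm := List.perm_insertionSort (· ≤ ·) (fourDigits b x)
  have hsorted := List.pairwise_insertionSort (· ≤ ·) (fourDigits b x)
  have hlt : ∀ z ∈ fourDigits b x, z < b := by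
    simp [fourDigits, Nat.mod_lt _ hb]
  obtain ⟨p, q, r, t, h⟩ := List.length_eq_four.mp hperm.length_eq
  rw [h] at hperm hsorted
  have hperm' : ((fourDigits b x).insertionSort (· ≥ ·)).Perm [p, q, r, t].reverse :=
    (List.perm_insertionSort _ _).trans (hperm.symm.trans (List.reverse_perm _).symm)
  have hrev : (fourDigits b x).insertionSort (· ≥ ·) = [p, q, r, t].reverse :=
    hperm'.eq_of_pairwise' (List.pairwise_insertionSort (· ≥ ·) _)
      (List.pairwise_reverse.mpr hsorted)
  simp only [List.pairwise_cons, List.mem_cons, List.not_mem_nil, or_false] at hsorted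
  exact ⟨p, q, r, t, hsorted.1 q (by simp), hsorted.2.1 r (by simp), hsorted.2.2.1 t (by simp),
    hlt t (hperm.subset (by simp)), h, hrev⟩

theorem kaprekar_eq_pairValue {b : ℕ} (hb : 0 < b) (x : ℕ) :
    kaprekar b x = pairValue b (digitDiffs b x) := by
  obtain ⟨p, q, r, t, hpq, hqr, hrt, -, hasc, hdesc⟩ := exists_sorted_fourDigits hb x
  have h3 : b ^ 3 = b ^ 3 - 1 + 1 := (Nat.sub_add_cancel (Nat.one_le_pow _ _ hb)).symm
  have h2 : b ^ 2 = b ^ 2 - b + b := (Nat.sub_add_cancel (Nat.le_self_pow two_ne_zero b)).symm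
  simp only [kaprekar, digitDiffs, hasc, hdesc, outerInner, pairValue, Sym2.sup_mk, Sym2.inf_mk,
    sup_eq_left.mpr (show r - q ≤ t - p by omega), inf_eq_right.mpr (show r - q ≤ t - p by omega),
    Nat.ofDigits_cons, Nat.ofDigits_nil]
  apply Nat.sub_eq_of_eq_add
  zify [hqr, hpq.trans (hqr.trans hrt)] at h2 h3 ⊢
  linear_combination (t - p : ℤ) * h3 + (r - q : ℤ) * h2

theorem sup_digitDiffs_lt {b : ℕ} (hb : 0 < b) (x : ℕ) : (digitDiffs b x).sup < b := by
  obtain ⟨p, q, r, t, -, -, hrt, htb, hasc, -⟩ := exists_sorted_fourDigits hb x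
  simp only [digitDiffs, hasc, outerInner, Sym2.sup_mk, sup_lt_iff]
  omega

theorem fourDigits_ofDigits {b p q r t : ℕ} (hp : p < b) (hq : q < b) (hr : r < b) (ht : t < b) :
    fourDigits b (Nat.ofDigits b [p, q, r, t]) = [p, q, r, t] := by
  have hb : 0 < b := by omega
  have hlt : ∀ z ∈ [p, q, r, t], z < b := by simp [hp, hq, hr, ht]
  have hdiv (i : ℕ) := Nat.ofDigits_div_pow_eq_ofDigits_drop i hb [p, q, r, t] hlt
  have hdiv1 := hdiv 1
  rw [pow_one] at hdiv1
  rw [fourDigits, hdiv1, hdiv 2, hdiv 3]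
  simp [Nat.ofDigits_cons, Nat.mod_eq_of_lt, hp, hq, hr, ht]

theorem outerInner_insertionSort (p q r t : ℕ) :
    outerInner ([p, q, r, t].insertionSort (· ≤ ·)) =
      s(max (max p t) (max q r) - min (min p t) (min q r),
        Nat.dist (max (min p t) (min q r)) (min (max p t) (max q r))) := by
  simp only [List.insertionSort, List.foldr, List.orderedInsert]
  split_ifs <;> simp only [List.orderedInsert] <;> split_ifs <;>
    simp only [List.orderedInsert] <;> split_ifs <;>
    simp only [outerInner, Nat.dist] <;> congr 2 <;> omega

theorem exists_mk_of_le (p : Sym2 ℕ) : ∃ x y, y ≤ x ∧ p = s(x, y) := by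
  induction p with | _ x y
  rcases le_total y x with h | h
  · exact ⟨x, y, h, rfl⟩
  · exact ⟨y, x, h, Sym2.eq_swap⟩

theorem pairValue_of_le {b x y : ℕ} (hyx : y ≤ x) :
    pairValue b s(x, y) = x * (b ^ 3 - 1) + y * (b ^ 2 - b) := by
  simp [pairValue, hyx]

theorem pairValue_zero_right {b w : ℕ} (hw : 0 < w) (hwb : w < b) :
    pairValue b s(w, 0) = Nat.ofDigits b [b - w, b - 1, b - 1, w - 1] := by
  rw [pairValue_of_le w.zero_le]
  have hb : 1 ≤ b := by omega
  simp only [Nat.ofDigits_cons, Nat.ofDigits_nil]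
  zify [hwb.le, hw, hb, Nat.one_le_pow 3 b hb, Nat.le_self_pow two_ne_zero b]
  ring

theorem pairValue_of_pos {b x y : ℕ} (hy : 0 < y) (hyx : y ≤ x) (hx : x < b) :
    pairValue b s(x, y) = Nat.ofDigits b [b - x, b - 1 - y, y - 1, x] := by
  rw [pairValue_of_le hyx]
  have hb : 1 ≤ b := by omega
  simp only [Nat.ofDigits_cons, Nat.ofDigits_nil]
  zify [hx.le, hy, hb, show y ≤ b - 1 by omega, Nat.one_le_pow 3 b hb,
    Nat.le_self_pow two_ne_zero b]
  ring

theorem digitDiffs_pairValue {b : ℕ} {p : Sym2 ℕ} (hp : p.sup < b) :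
    digitDiffs b (pairValue b p) = step b p := by
  obtain ⟨x, y, hyx, rfl⟩ := exists_mk_of_le p
  have hx : x < b := (le_sup_left (a := x) (b := y)).trans_lt hp
  rcases Nat.eq_zero_or_pos y with rfl | hy
  · rcases Nat.eq_zero_or_pos x with rfl | hx0
    · simp [pairValue, digitDiffs, fourDigits, outerInner, step_zero_zero]
    · rw [pairValue_zero_right hx0 hx, digitDiffs,
        fourDigits_ofDigits (by omega) (by omega) (by omega) (by omega),
        step_zero_right hx0, outerInner_insertionSort, complementPair, Sym2.eq_iff]
      simp only [Nat.dist]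
      omega
  · rw [pairValue_of_pos hy hyx hx, digitDiffs,
      fourDigits_ofDigits (by omega) (by omega) (by omega) (by omega), outerInner_insertionSort]
    -- Doubled, the outer digits are `b ± fold b x` and the inner ones `b - 2 ± fold b y`.
    have hmax : max (b - x) x + max (b - x) x = b + fold b x := by
      simp only [fold, Nat.dist]; omega
    have hmin : min (b - x) x + max (b - x) x = b := by omega
    have hmax' : max (b - 1 - y) (y - 1) + max (b - 1 - y) (y - 1) + 2 = b + fold b y := by
      simp only [fold, Nat.dist]; omega
    have hmin' : min (b - 1 - y) (y - 1) + max (b - 1 - y) (y - 1) + 2 = b := by omega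
    generalize max (b - x) x = M at *
    generalize min (b - x) x = m at *
    generalize max (b - 1 - y) (y - 1) = M' at *
    generalize min (b - 1 - y) (y - 1) = m' at *
    by_cases h : fold b x = fold b y
    · rw [step_eq_collisionPair (hy.trans_le hyx) hy h, collisionPair, Sym2.eq_iff]
      simp only [Nat.dist]
      omega
    · rw [step_eq_map (hy.trans_le hyx) hy h, Sym2.eq_iff]
      simp only [Nat.dist]
      omega

theorem digitDiffs_add_mul {b x y : ℕ} (hx : x < b) (hy : y < b) :
    digitDiffs b (x + b * y) = s(x, y) := by
  have hb : 0 < b := by omega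
  have h := fourDigits_ofDigits hx hy hb hb
  rw [show Nat.ofDigits b [x, y, 0, 0] = x + b * y by simp [Nat.ofDigits_cons]] at h
  rw [digitDiffs, h, outerInner_insertionSort, Sym2.eq_iff]
  simp only [Nat.dist]
  omega

theorem sup_step_lt {b : ℕ} {p : Sym2 ℕ} (hp : p.sup < b) : (step b p).sup < b := by
  rw [← digitDiffs_pairValue hp]
  exact sup_digitDiffs_lt (by omega) _

theorem sup_step_iterate_lt {b : ℕ} {p : Sym2 ℕ} (hp : p.sup < b) (t : ℕ) :
    ((step b)^[t] p).sup < b :=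
  Function.Iterate.rec (fun q : Sym2 ℕ => q.sup < b) hp (fun _ => sup_step_lt) t

theorem kaprekar_iterate_succ {b : ℕ} (hb : 0 < b) (x t : ℕ) :
    (kaprekar b)^[t + 1] x = pairValue b ((step b)^[t] (digitDiffs b x)) := by
  induction t with
  | zero => exact kaprekar_eq_pairValue hb x
  | succ t ih =>
    rw [Function.iterate_succ_apply', ih, kaprekar_eq_pairValue hb, digitDiffs_pairValue
      (sup_step_iterate_lt (sup_digitDiffs_lt hb x) t), ← Function.iterate_succ_apply' (step b)]

-- Modulo `b` the value is the negative of the larger difference, which is therefore determined.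
theorem pairValue_injOn (b : ℕ) : Set.InjOn (pairValue b) {p | p.sup < b} := by
  intro p hp q hq h
  obtain ⟨x, y, hyx, rfl⟩ := exists_mk_of_le p
  obtain ⟨x', y', hyx', rfl⟩ := exists_mk_of_le q
  simp only [Set.mem_ofPred_eq, Sym2.sup_mk, sup_eq_left.mpr hyx, sup_eq_left.mpr hyx'] at hp hq
  rw [pairValue_of_le hyx, pairValue_of_le hyx'] at h
  have hb : 1 ≤ b := by omega
  have hsup : x = x' := by
    apply Nat.ModEq.eq_of_lt_of_lt _ hp hq
    rw [← Int.natCast_modEq_iff, Int.modEq_iff_dvd]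
    zify [Nat.one_le_pow 3 b hb, Nat.le_self_pow two_ne_zero b] at h
    exact ⟨(x' - x) * b ^ 2 + (y' - y) * (b - 1), by linear_combination h⟩
  subst hsup
  by_cases hb1 : b = 1
  · rw [show y = y' by omega]
  · have hpos : 0 < b ^ 2 - b :=
      Nat.sub_pos_of_lt (lt_self_pow₀ (by omega) one_lt_two)
    rw [Nat.eq_of_mul_eq_mul_right hpos (Nat.add_left_cancel h)]

theorem isNonzeroFixedPoint_pairValue_iff {b : ℕ} {p : Sym2 ℕ} (hp : p.sup < b) :
    IsNonzeroFixedPoint b (pairValue b p) ↔ IsNonzeroFixedPair b p := by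
  have hb : 0 < b := by omega
  have hzero : pairValue b p = 0 ↔ p = s(0, 0) := by
    rw [← (pairValue_injOn b).eq_iff hp (show Sym2.sup s(0, 0) < b from hb)]
    simp [pairValue]
  rw [IsNonzeroFixedPoint, Function.IsFixedPt, kaprekar_eq_pairValue hb, digitDiffs_pairValue hp,
    (pairValue_injOn b).eq_iff (sup_step_lt hp) hp, Ne, hzero, IsNonzeroFixedPair, Ne]

theorem isNonzeroFixedPoint_iterate_succ_iff {b : ℕ} (hb : 0 < b) (x t : ℕ) :
    IsNonzeroFixedPoint b ((kaprekar b)^[t + 1] x) ↔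
      IsNonzeroFixedPair b ((step b)^[t] (digitDiffs b x)) := by
  rw [kaprekar_iterate_succ hb,
    isNonzeroFixedPoint_pairValue_iff (sup_step_iterate_lt (sup_digitDiffs_lt hb x) t)]

theorem isMaxDistance_succ {b M : ℕ}
    (upper : ∀ x < b ^ 4, ReachesWithin (kaprekar b) (IsNonzeroFixedPoint b) x (M + 1))
    (lower : ∃ x < b ^ 4, IsNonzeroFixedPoint b ((kaprekar b)^[M + 1] x) ∧
      ¬ IsNonzeroFixedPoint b ((kaprekar b)^[M] x)) :
    IsMaxDistance b (M + 1) := by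
  constructor
  · obtain ⟨x, hx, hreach, hearlier⟩ := lower
    refine ⟨x, hx, hreach, fun t ht => ?_⟩
    by_contra! hlt
    exact hearlier (iterate_of_forall_fixed (fun _ h => h.2) ht (Nat.le_of_lt_succ hlt))
  · rintro t ⟨x, hx, hreach, hleast⟩
    exact hleast (upper x hx t hreach)

/-- If the pair `p` ever becomes a nonzero fixed pair, it is one after `t` steps. -/
abbrev SettlesWithin (b : ℕ) (p : Sym2 ℕ) (t : ℕ) : Prop :=
  ReachesWithin (step b) (IsNonzeroFixedPair b) p t

-- The first application of the Kaprekar map only replaces a numeral by its digit differences.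
theorem isMaxDistance_add_two {b M : ℕ}
    (upper : ∀ p : Sym2 ℕ, p.sup < b → SettlesWithin b p (M + 1))
    (lower : ∃ p : Sym2 ℕ, p.sup < b ∧ IsNonzeroFixedPair b ((step b)^[M + 1] p) ∧
      ¬ IsNonzeroFixedPair b ((step b)^[M] p)) :
    IsMaxDistance b (M + 2) := by
  obtain ⟨p, hp, hreach, hearlier⟩ := lower
  have hb : 0 < b := by omega
  refine isMaxDistance_succ (fun x _ t ht => ?_) ?_
  · rw [isNonzeroFixedPoint_iterate_succ_iff hb]
    apply upper _ (sup_digitDiffs_lt hb x) t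
    rw [← isNonzeroFixedPoint_iterate_succ_iff hb]
    exact iterate_of_forall_fixed (fun _ h => h.2) ht t.le_succ
  · induction p with | _ u v
    obtain ⟨hu, hv⟩ : u < b ∧ v < b := sup_lt_iff.mp hp
    refine ⟨u + b * v, ?_, ?_⟩
    · calc u + b * v < b ^ 2 := by nlinarith
        _ ≤ b ^ 4 := Nat.pow_le_pow_right hb (by norm_num)
    · rw [isNonzeroFixedPoint_iterate_succ_iff hb, isNonzeroFixedPoint_iterate_succ_iff hb,
        digitDiffs_add_mul hu hv]
      exact ⟨hreach, hearlier⟩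

/-! ### Small bases -/

instance (b : ℕ) : DecidablePred (IsNonzeroFixedPoint b) := fun y =>
  inferInstanceAs (Decidable (y ≠ 0 ∧ kaprekar b y = y))

instance (b : ℕ) : DecidablePred (IsNonzeroFixedPair b) := fun p =>
  inferInstanceAs (Decidable (p ≠ s(0, 0) ∧ step b p = p))

theorem isMaxDistance_succ_of_iterate_add_eq {b M d : ℕ} (hd : 0 < d)
    (upper : ∀ x < b ^ 4, (kaprekar b)^[d + (M + 1)] x = (kaprekar b)^[M + 1] x)
    (lower : ∃ x < b ^ 4, IsNonzeroFixedPoint b ((kaprekar b)^[M + 1] x) ∧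
      ¬ IsNonzeroFixedPoint b ((kaprekar b)^[M] x)) :
    IsMaxDistance b (M + 1) :=
  isMaxDistance_succ
    (fun x hx => reachesWithin_of_iterate_add_eq (fun _ h => h.2) hd (upper x hx)) lower

theorem isMaxDistance_two : IsMaxDistance 2 1 :=
  isMaxDistance_succ_of_iterate_add_eq one_pos (by decide +kernel) (by decide +kernel)

theorem isMaxDistance_four : IsMaxDistance 4 3 :=
  isMaxDistance_succ_of_iterate_add_eq (d := 6) (by norm_num) (by decide +kernel)
    (by decide +kernel)

theorem isMaxDistance_add_two_of_forall_lt {b M d : ℕ} (hd : 0 < d)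
    (upper : ∀ x < b, ∀ y < b,
      (step b)^[d + (M + 1)] s(x, y) = (step b)^[M + 1] s(x, y))
    (lower : ∃ x < b, ∃ y < b, IsNonzeroFixedPair b ((step b)^[M + 1] s(x, y)) ∧
      ¬ IsNonzeroFixedPair b ((step b)^[M] s(x, y))) :
    IsMaxDistance b (M + 2) := by
  obtain ⟨x, hx, y, hy, hreach, hearlier⟩ := lower
  refine isMaxDistance_add_two (fun p hp => ?_) ⟨s(x, y), sup_lt_iff.mpr ⟨hx, hy⟩, hreach, hearlier⟩
  induction p with | _ u v
  obtain ⟨hu, hv⟩ : u < b ∧ v < b := sup_lt_iff.mp hp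
  exact reachesWithin_of_iterate_add_eq (fun _ h => h.2) hd (upper u hu v hv)

theorem isMaxDistance_five : IsMaxDistance 5 4 :=
  isMaxDistance_add_two_of_forall_lt one_pos (by decide +kernel) (by decide +kernel)

theorem isMaxDistance_ten : IsMaxDistance 10 7 :=
  isMaxDistance_add_two_of_forall_lt one_pos (by decide +kernel) (by decide +kernel)

theorem isMaxDistance_twenty : IsMaxDistance 20 10 :=
  isMaxDistance_add_two_of_forall_lt (d := 6) (by norm_num) (by decide +kernel)
    (by decide +kernel)

/-! ### Folds and their iterates -/

section Fold

variable {b x y : ℕ}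

theorem fold_zero (b : ℕ) : fold b 0 = b := by simp [fold, Nat.dist]

theorem fold_self (b : ℕ) : fold b b = b := by unfold fold Nat.dist; omega

theorem fold_le (hx : x ≤ b) : fold b x ≤ b := by unfold fold Nat.dist; omega

theorem fold_mul (m b x : ℕ) : fold (b * m) (x * m) = fold b x * m := by
  rw [fold, fold, ← mul_assoc, Nat.dist_mul_right]

theorem fold_iterate_mul (m b x t : ℕ) : (fold (b * m))^[t] (x * m) = (fold b)^[t] x * m :=
  ((show Function.Semiconj (· * m) (fold b) (fold (b * m)) from
    fun y => (fold_mul m b y).symm).iterate_right t x).symm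

theorem fold_iterate_le (hx : x ≤ b) (t : ℕ) : (fold b)^[t] x ≤ b :=
  Function.Iterate.rec (· ≤ b) hx (fun _ => fold_le) t

theorem fold_iterate_ne_of_le {j t : ℕ} (h : (fold b)^[t] x ≠ b) (hj : j ≤ t) :
    (fold b)^[j] x ≠ b :=
  mt (fun h' => iterate_of_forall_fixed (P := (· = b)) (by rintro _ rfl; exact fold_self _) h' hj) h

theorem fold_iterate_pos {j t : ℕ} (h : (fold b)^[t] x ≠ b) (hj : j < t) :
    0 < (fold b)^[j] x := by
  refine Nat.pos_of_ne_zero fun h0 => fold_iterate_ne_of_le h (Nat.succ_le_of_lt hj) ?_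
  rw [Function.iterate_succ_apply', h0, fold_zero]

theorem fold_fold_two_mul {B r : ℕ} (hr : r < 2 * B) :
    fold (2 * B) (fold (2 * B) r) = 2 * fold B (r % B) := by
  rcases lt_or_ge r B with h | h
  · rw [Nat.mod_eq_of_lt h]
    unfold fold Nat.dist
    omega
  · rw [Nat.mod_eq_sub_mod h, Nat.mod_eq_of_lt (by omega)]
    unfold fold Nat.dist
    omega

theorem fold_iterate_succ_mul_two_pow {B s : ℕ} (hx : x ≤ B * 2 ^ s) :
    (fold (B * 2 ^ s))^[s + 1] x = fold B (x % B) * 2 ^ s := by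
  induction s generalizing B with
  | zero =>
    rcases (show x ≤ B by simpa using hx).lt_or_eq with h | rfl
    · simp [Nat.mod_eq_of_lt h]
    · simp [fold_self, fold_zero]
  | succ s ih =>
    rcases Nat.eq_zero_or_pos B with rfl | hB
    · obtain rfl : x = 0 := by simpa using hx
      simp [fold_zero, Function.iterate_fixed (fold_zero 0)]
    have hb : B * 2 ^ (s + 1) = 2 * B * 2 ^ s := by ring
    rw [hb] at hx
    rw [Function.iterate_succ_apply', hb, ih hx, fold_mul,
      fold_fold_two_mul (Nat.mod_lt _ (by omega)), Nat.mod_mod_of_dvd _ (Dvd.intro_left 2 rfl)]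
    ring

theorem fold_iterate_mul_two_pow {C t : ℕ} (ht : 0 < t) (hx : x ≤ C * 2 ^ t) :
    (fold (C * 2 ^ t))^[t] x = Nat.dist C (x % (2 * C)) * 2 ^ t := by
  obtain ⟨s, rfl⟩ := Nat.exists_eq_add_of_le' ht
  have hb : C * 2 ^ (s + 1) = 2 * C * 2 ^ s := by ring
  rw [hb] at hx ⊢
  rw [fold_iterate_succ_mul_two_pow hx, fold, Nat.dist_mul_left]
  ring

theorem fold_iterate_mul_of_odd {C c t : ℕ} (ht : 0 < t) (hc : c % 2 = 1) (hct : c ≤ 2 ^ t) :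
    (fold (C * 2 ^ t))^[t] (C * c) = 0 := by
  rw [fold_iterate_mul_two_pow ht (Nat.mul_le_mul_left C hct), mul_comm 2 C, Nat.mul_mod_mul_left,
    hc, mul_one, Nat.dist_self, zero_mul]

theorem fold_iterate_add_one_eq_sub_one {C u t : ℕ} (hC : 1 < C) (ht : 0 < t)
    (hu : u < C * 2 ^ t) (h : (fold (C * 2 ^ t))^[t] u = 0) :
    (fold (C * 2 ^ t))^[t] (u + 1) = (fold (C * 2 ^ t))^[t] (u - 1) := by
  have hmod : C = u % (2 * C) := by
    rw [fold_iterate_mul_two_pow ht hu.le, mul_eq_zero_iff_right (by positivity)] at h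
    exact Nat.eq_of_dist_eq_zero h
  obtain ⟨q, rfl⟩ : ∃ q, u = q * (2 * C) + C := ⟨u / (2 * C), by
    conv_lhs => rw [← Nat.div_add_mod' u (2 * C), ← hmod]⟩
  rw [fold_iterate_mul_two_pow ht hu, fold_iterate_mul_two_pow ht (by omega),
    Nat.succ_eq_add_one, add_assoc, Nat.add_sub_assoc hC.le, Nat.mul_add_mod_of_lt (by omega),
    Nat.mul_add_mod_of_lt (by omega), Nat.dist_eq_sub_of_le (by omega),
    Nat.dist_eq_sub_of_le_right (by omega)]
  congr 1
  omega

theorem dvd_fold_iff {m : ℕ} (hm : Nat.Coprime m 2) (hb : m ∣ b) : m ∣ fold b x ↔ m ∣ x := by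
  rw [fold, Nat.dist]
  rcases le_total b (2 * x) with h | h
  · rw [Nat.sub_eq_zero_of_le h, zero_add, Nat.dvd_sub_iff_left h hb, hm.dvd_mul_left]
  · rw [Nat.sub_eq_zero_of_le h, add_zero, Nat.dvd_sub_iff_right h hb, hm.dvd_mul_left]

theorem dvd_fold_iterate_iff {m : ℕ} (hm : Nat.Coprime m 2) (hb : m ∣ b) (t : ℕ) :
    m ∣ (fold b)^[t] x ↔ m ∣ x := by
  induction t with
  | zero => rfl
  | succ t ih => rw [Function.iterate_succ_apply', dvd_fold_iff hm hb, ih]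

theorem fold_iterate_mod_two {t : ℕ} (hb : b % 2 = 0) (ht : 0 < t) :
    (fold b)^[t] x % 2 = 0 := by
  obtain ⟨s, rfl⟩ := Nat.exists_eq_add_of_le' ht
  rw [Function.iterate_succ_apply']
  unfold fold Nat.dist
  omega

end Fold

section Step

variable {b x y t : ℕ}

theorem step_iterate_eq_map (hx : (fold b)^[t] x ≠ b) (hy : (fold b)^[t] y ≠ b)
    (hxy : (fold b)^[t] x ≠ (fold b)^[t] y) :
    (step b)^[t] s(x, y) = s((fold b)^[t] x, (fold b)^[t] y) := by
  induction t with
  | zero => rfl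
  | succ t ih =>
    have hx' := fold_iterate_ne_of_le hx t.le_succ
    have hy' := fold_iterate_ne_of_le hy t.le_succ
    have hx0 := fold_iterate_pos hx t.lt_succ_self
    have hy0 := fold_iterate_pos hy t.lt_succ_self
    simp only [Function.iterate_succ_apply'] at hxy ⊢
    rw [ih hx' hy' (fun h => hxy (by rw [h])), step_eq_map hx0 hy0 hxy]

theorem exists_step_iterate_eq_collisionPair (ht : 0 < t)
    (hxy : (fold b)^[t] x = (fold b)^[t] y) (hx : (fold b)^[t] x ≠ b) :
    ∃ j, 0 < j ∧ j ≤ t ∧ (step b)^[j] s(x, y) = collisionPair ((fold b)^[j] x) := by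
  induction t generalizing x y with
  | zero => exact absurd ht (lt_irrefl 0)
  | succ t ih =>
    have hx0 : 0 < x := fold_iterate_pos hx ht
    have hy0 : 0 < y := fold_iterate_pos (hxy ▸ hx) ht
    by_cases h : fold b x = fold b y
    · exact ⟨1, one_pos, ht, step_eq_collisionPair hx0 hy0 h⟩
    · have ht0 : 0 < t := by
        rcases Nat.eq_zero_or_pos t with rfl | ht0
        · exact absurd hxy h
        · exact ht0
      obtain ⟨j, -, hjt, hj⟩ := ih ht0 hxy hx
      refine ⟨j + 1, j.succ_pos, Nat.succ_le_succ hjt, ?_⟩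
      rw [Function.iterate_succ_apply, step_eq_map hx0 hy0 h, hj, ← Function.iterate_succ_apply]

-- The parities of the entries keep them apart at time `n`.
theorem step_iterate_succ_eq_collisionPair {B n : ℕ} (hn : 0 < n) (hx : x ≤ B * 2 ^ n)
    (hy : y ≤ B * 2 ^ n) (hodd : (x + y) % 2 = 1) (hxy : fold B (x % B) = fold B (y % B))
    (hxB : fold B (x % B) ≠ B) :
    (step (B * 2 ^ n))^[n + 1] s(x, y) = collisionPair (fold B (x % B) * 2 ^ n) := by
  have hpow : 0 < 2 ^ n := by positivity
  have hx' := fold_iterate_succ_mul_two_pow hx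
  have hy' := fold_iterate_succ_mul_two_pow hy
  have hxb : (fold (B * 2 ^ n))^[n + 1] x ≠ B * 2 ^ n := by
    rw [hx']
    exact mt (Nat.eq_of_mul_eq_mul_right hpow) hxB
  have hyb : (fold (B * 2 ^ n))^[n + 1] y ≠ B * 2 ^ n := by rwa [hy', ← hxy, ← hx']
  have hne : (fold (B * 2 ^ n))^[n] x ≠ (fold (B * 2 ^ n))^[n] y := by
    rw [fold_iterate_mul_two_pow hn hx, fold_iterate_mul_two_pow hn hy]
    refine mt (Nat.eq_of_mul_eq_mul_right hpow) ?_
    have h1 := Nat.mod_mul_right_mod x 2 B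
    have h2 := Nat.mod_mul_right_mod y 2 B
    unfold Nat.dist
    omega
  rw [Function.iterate_succ_apply', step_iterate_eq_map (fold_iterate_ne_of_le hxb n.le_succ)
    (fold_iterate_ne_of_le hyb n.le_succ) hne, step_eq_collisionPair
    (fold_iterate_pos hxb n.lt_succ_self) (fold_iterate_pos hyb n.lt_succ_self)] <;>
  rw [← Function.iterate_succ_apply' (fold _), hx']
  rw [← Function.iterate_succ_apply' (fold _), hy', hxy]

-- After `t` steps the entry `C * c` has become `0`.
theorem step_iterate_succ_eq_complementPair {C c : ℕ} (ht : 0 < t) (hc : c % 2 = 1)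
    (hct : c ≤ 2 ^ t) (hy : y ≤ C * 2 ^ t) (hCy : ¬ C ∣ y) :
    (step (C * 2 ^ t))^[t + 1] s(C * c, y) =
      complementPair (C * 2 ^ t) (Nat.dist C (y % (2 * C)) * 2 ^ t) := by
  have hpow : 0 < 2 ^ t := by positivity
  have hC : 0 < C := by
    rcases Nat.eq_zero_or_pos C with rfl | hC
    · simp_all
    · exact hC
  have hfoldC : (fold (C * 2 ^ t))^[t] (C * c) = 0 := fold_iterate_mul_of_odd ht hc hct
  have hdvd : ¬ C ∣ y % (2 * C) := by rwa [Nat.dvd_mod_iff (Dvd.intro_left 2 rfl)]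
  have hyC : y % (2 * C) ≠ C := fun h => hdvd (by rw [h])
  have hy0 : y % (2 * C) ≠ 0 := fun h => hdvd (by rw [h]; exact dvd_zero C)
  have hlt : y % (2 * C) < 2 * C := Nat.mod_lt _ (by omega)
  have hpos : 0 < Nat.dist C (y % (2 * C)) := by unfold Nat.dist; omega
  have hne : Nat.dist C (y % (2 * C)) ≠ C := by unfold Nat.dist; omega
  have hfoldy := fold_iterate_mul_two_pow ht hy
  rw [Function.iterate_succ_apply', step_iterate_eq_map, hfoldC, hfoldy, Sym2.eq_swap,
    step_zero_right (Nat.mul_pos hpos hpow)]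
  · rw [hfoldC]
    exact (Nat.mul_pos hC hpow).ne
  · rw [hfoldy]
    exact mt (Nat.eq_of_mul_eq_mul_right hpow) hne
  · rw [hfoldC, hfoldy]
    exact (Nat.mul_pos hpos hpow).ne

theorem step_iterate_succ_eq_complementPair_two_pow {C c : ℕ} (hC : 1 < C) (ht : 0 < t)
    (hc : c % 2 = 1) (hct : c ≤ 2 ^ t) (hy : y ≤ C * 2 ^ t)
    (hCy : y % (2 * C) = C - 1) :
    (step (C * 2 ^ t))^[t + 1] s(C * c, y) = complementPair (C * 2 ^ t) (2 ^ t) := by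
  have hdvd : ¬ C ∣ y := by
    rw [← Nat.dvd_mod_iff (Dvd.intro_left 2 rfl : C ∣ 2 * C), hCy]
    exact Nat.not_dvd_of_pos_of_lt (by omega) (by omega)
  rw [step_iterate_succ_eq_complementPair ht hc hct hy hdvd, hCy,
    show Nat.dist C (C - 1) = 1 by unfold Nat.dist; omega, one_mul]

theorem mul_sub_one_mod_two_mul {C c : ℕ} (hC : 1 < C) (hc : c % 2 = 1) :
    (C * c - 1) % (2 * C) = C - 1 := by
  obtain ⟨q, rfl⟩ : ∃ q, c = 2 * q + 1 := ⟨c / 2, by omega⟩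
  rw [show C * (2 * q + 1) - 1 = C - 1 + 2 * C * q by
    rw [← Nat.sub_add_comm hC.le]; congr 1; ring, Nat.add_mul_mod_self_left,
    Nat.mod_eq_of_lt (by omega)]

theorem step_iterate_complementPair_mul {C c : ℕ} (hC : 1 < C) (ht : 0 < t) (hc : c % 2 = 1)
    (hct : c < 2 ^ t) :
    (step (C * 2 ^ t))^[t + 1] (complementPair (C * 2 ^ t) (C * c)) =
      complementPair (C * 2 ^ t) (2 ^ t) := by
  have heven : 2 ^ t % 2 = 0 := Nat.two_pow_mod_two_eq_zero.mpr ht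
  have hle : C * c ≤ C * 2 ^ t := Nat.mul_le_mul_left C hct.le
  rw [complementPair, ← Nat.mul_sub]
  exact step_iterate_succ_eq_complementPair_two_pow hC ht (by omega)
    (Nat.sub_le _ _) (by omega) (mul_sub_one_mod_two_mul hC hc)

theorem step_iterate_complementPair_mul_add_one {C c : ℕ} (hC : 1 < C) (ht : 0 < t)
    (hc : c % 2 = 1) (hct : c < 2 ^ t) :
    (step (C * 2 ^ t))^[t + 1] (complementPair (C * 2 ^ t) (C * c + 1)) =
      complementPair (C * 2 ^ t) (2 ^ t) := by
  have heven : 2 ^ t % 2 = 0 := Nat.two_pow_mod_two_eq_zero.mpr ht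
  rw [complementPair, Sym2.eq_swap, Nat.add_sub_cancel, ← Nat.sub_sub, ← Nat.mul_sub]
  exact step_iterate_succ_eq_complementPair_two_pow hC ht hc hct.le
    ((Nat.sub_le _ _).trans (Nat.mul_le_mul_left C (Nat.sub_le _ _)))
    (mul_sub_one_mod_two_mul hC (by omega))

end Step

/-! ### Bases divisible by five -/

theorem isNonzeroFixedPair_three_mul {k : ℕ} (hk : 0 < k) :
    IsNonzeroFixedPair (5 * k) s(3 * k, k) := by
  have hthree : fold (5 * k) (3 * k) = k := by unfold fold Nat.dist; omega
  have hone : fold (5 * k) k = 3 * k := by unfold fold Nat.dist; omega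
  refine ⟨by rw [Ne, Sym2.eq_iff]; omega, ?_⟩
  rw [step_eq_map (by omega) hk (by omega), hthree, hone, Sym2.eq_swap]

theorem IsNonzeroFixedPair.eq_three_mul {k : ℕ} {p : Sym2 ℕ} (hp : p.sup < 5 * k)
    (h : IsNonzeroFixedPair (5 * k) p) : p = s(3 * k, k) := by
  obtain ⟨x, y, hyx, rfl⟩ := exists_mk_of_le p
  obtain ⟨hx, -⟩ : x < 5 * k ∧ y < 5 * k := sup_lt_iff.mp hp
  obtain ⟨hne, hfix⟩ := h
  rw [Ne, Sym2.eq_iff] at hne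
  rcases Nat.eq_zero_or_pos y with rfl | hy
  · rw [step_zero_right (by omega), complementPair, Sym2.eq_iff] at hfix
    omega
  by_cases hfold : fold (5 * k) x = fold (5 * k) y
  · rw [step_eq_collisionPair (by omega) hy hfold, collisionPair, Sym2.eq_iff] at hfix
    unfold fold Nat.dist at hfix hfold
    omega
  · rw [step_eq_map (by omega) hy hfold, Sym2.eq_iff] at hfix
    rw [Sym2.eq_iff]
    unfold fold Nat.dist at hfix hfold
    omega

theorem SettlesWithin.of_iterate_eq {b d t t' : ℕ} {p q : Sym2 ℕ} (h : SettlesWithin b q t)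
    (hpq : (step b)^[d] p = q) (ht : t + d ≤ t') : SettlesWithin b p t' := by
  subst hpq
  exact (ReachesWithin.of_iterate (fun _ h => h.2) h).mono (fun _ h => h.2) ht

theorem SettlesWithin.mono {b t t' : ℕ} {p : Sym2 ℕ} (h : SettlesWithin b p t) (ht : t ≤ t') :
    SettlesWithin b p t' :=
  h.of_iterate_eq (d := 0) rfl ht

theorem settlesWithin_of_eq {k t : ℕ} (hk : 0 < k) {p : Sym2 ℕ}
    (h : (step (5 * k))^[t] p = s(3 * k, k)) : SettlesWithin (5 * k) p t :=
  fun _ _ => h ▸ isNonzeroFixedPair_three_mul hk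

theorem settlesWithin_zero_zero (b t : ℕ) : SettlesWithin b s(0, 0) t := by
  intro j hj
  rw [Function.iterate_fixed (step_zero_zero b)] at hj
  exact absurd rfl hj.1

section PowerOfTwo

variable {n x y : ℕ}

theorem fold_five_of_opposite (hx5 : x % 5 ≠ 0) (hxy : y % 5 = 2 * x % 5 ∨ y % 5 = 3 * x % 5) :
    fold 5 (x % 5) = 3 ∧ fold 5 (y % 5) = 1 ∨ fold 5 (x % 5) = 1 ∧ fold 5 (y % 5) = 3 := by
  unfold fold Nat.dist
  omega

theorem step_iterate_eq_of_opposite (hx : x ≤ 5 * 2 ^ n) (hy : y ≤ 5 * 2 ^ n) (hx5 : x % 5 ≠ 0)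
    (hxy : y % 5 = 2 * x % 5 ∨ y % 5 = 3 * x % 5) :
    (step (5 * 2 ^ n))^[n + 1] s(x, y) = s(3 * 2 ^ n, 2 ^ n) := by
  have hpow : 0 < 2 ^ n := by positivity
  have hx' := fold_iterate_succ_mul_two_pow hx
  have hy' := fold_iterate_succ_mul_two_pow hy
  rcases fold_five_of_opposite hx5 hxy with ⟨h3, h1⟩ | ⟨h1, h3⟩
  · rw [h3] at hx'
    rw [h1, one_mul] at hy'
    rw [step_iterate_eq_map (by omega) (by omega) (by omega), hx', hy']
  · rw [h1, one_mul] at hx'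
    rw [h3] at hy'
    rw [step_iterate_eq_map (by omega) (by omega) (by omega), hx', hy', Sym2.eq_swap]

theorem settlesWithin_of_opposite (hx : x ≤ 5 * 2 ^ n) (hy : y ≤ 5 * 2 ^ n) (hx5 : x % 5 ≠ 0)
    (hxy : y % 5 = 2 * x % 5 ∨ y % 5 = 3 * x % 5) :
    SettlesWithin (5 * 2 ^ n) s(x, y) (n + 1) :=
  settlesWithin_of_eq (by positivity) (step_iterate_eq_of_opposite hx hy hx5 hxy)

-- At time `n` the entry coming from the odd `x` is an even multiple of `2 ^ n`.
theorem not_isNonzeroFixedPair_step_iterate_of_odd (hn : 0 < n) (hx : x < 5 * 2 ^ n)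
    (hy : y < 5 * 2 ^ n) (hx5 : x % 5 ≠ 0) (hxy : y % 5 = 2 * x % 5 ∨ y % 5 = 3 * x % 5)
    (hodd : x % 2 = 1) :
    ¬ IsNonzeroFixedPair (5 * 2 ^ n) ((step (5 * 2 ^ n))^[n] s(x, y)) := by
  intro h
  have hpow : 0 < 2 ^ n := by positivity
  have hx' := fold_iterate_succ_mul_two_pow hx.le
  have hy' := fold_iterate_succ_mul_two_pow hy.le
  obtain ⟨hx5', hy5', hne⟩ : fold 5 (x % 5) ≠ 5 ∧ fold 5 (y % 5) ≠ 5 ∧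
      fold 5 (x % 5) ≠ fold 5 (y % 5) := by
    have := fold_five_of_opposite hx5 hxy
    omega
  have hmap : (step (5 * 2 ^ n))^[n] s(x, y) =
      s((fold (5 * 2 ^ n))^[n] x, (fold (5 * 2 ^ n))^[n] y) := by
    apply step_iterate_eq_map
    · refine fold_iterate_ne_of_le ?_ n.le_succ
      rw [hx']
      exact mt (Nat.eq_of_mul_eq_mul_right hpow) hx5'
    · refine fold_iterate_ne_of_le ?_ n.le_succ
      rw [hy']
      exact mt (Nat.eq_of_mul_eq_mul_right hpow) hy5'
    · intro heq
      rw [Function.iterate_succ_apply', heq, ← Function.iterate_succ_apply' (fold _), hy'] at hx'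
      exact hne (Nat.eq_of_mul_eq_mul_right hpow hx').symm
  have hfixed := h.eq_three_mul (sup_step_iterate_lt (sup_lt_iff.mpr ⟨hx, hy⟩) n)
  rw [hmap, Sym2.eq_iff, fold_iterate_mul_two_pow hn hx.le] at hfixed
  have hdist : Nat.dist 5 (x % (2 * 5)) = 3 ∨ Nat.dist 5 (x % (2 * 5)) = 1 := by
    rcases hfixed with ⟨h3, -⟩ | ⟨h1, -⟩
    · exact Or.inl (Nat.eq_of_mul_eq_mul_right hpow h3)
    · exact Or.inr (Nat.eq_of_mul_eq_mul_right hpow (h1.trans (one_mul _).symm))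
  unfold Nat.dist at hdist
  omega

theorem step_iterate_eq_of_multiple (hn : 0 < n) {c : ℕ} (hc : c % 2 = 1) (hcn : c ≤ 2 ^ n)
    (hy : y ≤ 5 * 2 ^ n) (hy10 : y % 10 = 3 ∨ y % 10 = 7) :
    (step (5 * 2 ^ n))^[n + 1] s(5 * c, y) = s(3 * 2 ^ n, 2 * 2 ^ n - 1) := by
  have hdist : Nat.dist 5 (y % (2 * 5)) = 2 := by unfold Nat.dist; omega
  rw [step_iterate_succ_eq_complementPair hn hc hcn hy (by omega), hdist, complementPair,
    ← Nat.sub_mul]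

theorem step_iterate_collisionPair (hn : 0 < n) {u : ℕ} (hu : u < 5 * 2 ^ n)
    (hu10 : u % 10 = 4 ∨ u % 10 = 6) :
    (step (5 * 2 ^ n))^[n + 1] (collisionPair u) = s(3 * 2 ^ n, 2 * 2 ^ n - 1) := by
  have hsub : Nat.dist u 1 = u - 1 := by unfold Nat.dist; omega
  rw [collisionPair, hsub]
  rcases hu10 with h | h
  · rw [show u + 1 = 5 * (2 * (u / 10) + 1) by omega]
    exact step_iterate_eq_of_multiple hn (by omega) (by omega) (by omega) (by omega)
  · rw [Sym2.eq_swap, show u - 1 = 5 * (2 * (u / 10) + 1) by omega]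
    exact step_iterate_eq_of_multiple hn (by omega) (by omega) (by omega) (by omega)

theorem settlesWithin_collisionPair {u : ℕ} (hu : u < 5 * 2 ^ n)
    (hu5 : u % 5 = 2 ∨ u % 5 = 3) :
    SettlesWithin (5 * 2 ^ n) (collisionPair u) (n + 1) := by
  have hsub : Nat.dist u 1 = u - 1 := by unfold Nat.dist; omega
  rw [collisionPair, hsub]
  exact settlesWithin_of_opposite hu (by omega) (by omega) (by omega)

theorem settlesWithin_complementPair {w : ℕ} (hw : w ≤ 5 * 2 ^ n)
    (hw5 : w % 5 = 2 ∨ w % 5 = 4) :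
    SettlesWithin (5 * 2 ^ n) (complementPair (5 * 2 ^ n) w) (n + 1) :=
  settlesWithin_of_opposite (Nat.sub_le _ _) (by omega) (by omega) (by omega)

theorem step_iterate_complementPair_eq_collisionPair (hn : 0 < n) {w : ℕ} (hw : w ≤ 5 * 2 ^ n)
    (hw5 : w % 5 = 3) :
    (step (5 * 2 ^ n))^[n + 1] (complementPair (5 * 2 ^ n) w) = collisionPair (2 ^ n) := by
  have heven : 2 ^ n % 2 = 0 := Nat.two_pow_mod_two_eq_zero.mpr hn
  have hleft : (5 * 2 ^ n - w) % 5 = 2 := by omega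
  have hright : (w - 1) % 5 = 2 := by omega
  have hfold : fold 5 2 = 1 := rfl
  rw [complementPair, step_iterate_succ_eq_collisionPair hn (Nat.sub_le _ _) (by omega) (by omega)
    (by rw [hleft, hright]) (by rw [hleft, hfold]; norm_num), hleft, hfold, one_mul]

theorem step_iterate_complementPair_eq_complementPair (hn : 0 < n) {w : ℕ} (hw : w < 5 * 2 ^ n)
    (hw10 : w % 10 = 6) :
    (step (5 * 2 ^ n))^[n + 1] (complementPair (5 * 2 ^ n) w) =
      complementPair (5 * 2 ^ n) (2 ^ n) := by
  rw [show w = 5 * (2 * (w / 10) + 1) + 1 by omega]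
  exact step_iterate_complementPair_mul_add_one (by norm_num) hn (by omega) (by omega)

theorem settlesWithin_one_one (hn : 0 < n) : SettlesWithin (5 * 2 ^ n) s(1, 1) (n + 2) := by
  have hpow : 2 ≤ 2 ^ n := Nat.le_self_pow hn.ne' 2
  have hfold : fold (5 * 2 ^ n) 1 = 5 * 2 ^ n - 2 := by unfold fold Nat.dist; omega
  refine (settlesWithin_collisionPair (n := n) (u := 5 * 2 ^ n - 2) (by omega)
    (by omega)).of_iterate_eq (d := 1) ?_ le_rfl
  rw [← hfold]
  exact step_eq_collisionPair one_pos one_pos rfl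

theorem exists_eq_five_mul_two_pow_mul_odd (hx0 : 0 < x) (hx : x < 5 * 2 ^ n) (hx5 : 5 ∣ x) :
    ∃ a t c, n = a + t ∧ 0 < t ∧ c % 2 = 1 ∧ c < 2 ^ t ∧ x = 5 * 2 ^ a * c := by
  obtain ⟨z, rfl⟩ := hx5
  obtain ⟨a, c, hc, rfl⟩ := Nat.exists_eq_two_pow_mul_odd (n := z) (by omega)
  have hlt : 2 ^ a * c < 2 ^ n := by omega
  have han : a < n := (Nat.pow_lt_pow_iff_right one_lt_two).mp
    ((Nat.le_mul_of_pos_right _ hc.pos).trans_lt hlt)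
  obtain ⟨t, rfl⟩ := Nat.exists_eq_add_of_le han.le
  rw [pow_add] at hlt
  exact ⟨a, t, c, rfl, by omega, Nat.odd_iff.mp hc, lt_of_mul_lt_mul_left' hlt, by ring⟩

/-- Settling times of the three critical pairs in base `5 * 2 ^ n`: `E` bounds those of the
collision and the complement pair of `2 ^ n`, and `F` bounds that of the pair reached from a
collision at an even `u ≡ ±1` modulo `5`. They govern the settling times of all pairs. -/
structure CriticalOrbitBounds (n E F : ℕ) : Prop where
  collision : SettlesWithin (5 * 2 ^ n) (collisionPair (2 ^ n)) E
  complement : SettlesWithin (5 * 2 ^ n) (complementPair (5 * 2 ^ n) (2 ^ n)) E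
  main : SettlesWithin (5 * 2 ^ n) s(3 * 2 ^ n, 2 * 2 ^ n - 1) F

namespace CriticalOrbitBounds

variable {E F : ℕ}

theorem collisionPair_even (h : CriticalOrbitBounds n E F) (hn : 0 < n) {u : ℕ}
    (hu : u < 5 * 2 ^ n) (hu2 : u % 2 = 0) (hu5 : u % 5 ≠ 0) :
    SettlesWithin (5 * 2 ^ n) (collisionPair u) (F + (n + 1)) := by
  by_cases hmid : u % 5 = 2 ∨ u % 5 = 3
  · exact (settlesWithin_collisionPair hu hmid).mono (by omega)
  · exact h.main.of_iterate_eq (step_iterate_collisionPair hn hu (by omega)) le_rfl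

theorem complementPair_even (h : CriticalOrbitBounds n E F) (hn : 0 < n) {w : ℕ}
    (hw : w < 5 * 2 ^ n) (hw2 : w % 2 = 0) (hw5 : w % 5 ≠ 0) :
    SettlesWithin (5 * 2 ^ n) (complementPair (5 * 2 ^ n) w) (E + (n + 1)) := by
  by_cases hsettle : w % 5 = 2 ∨ w % 5 = 4
  · exact (settlesWithin_complementPair hw.le hsettle).mono (by omega)
  by_cases hthree : w % 5 = 3
  · exact h.collision.of_iterate_eq
      (step_iterate_complementPair_eq_collisionPair hn hw.le hthree) le_rfl
  · exact h.complement.of_iterate_eq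
      (step_iterate_complementPair_eq_complementPair hn hw (by omega)) le_rfl

theorem complementPair_two_pow {t : ℕ} (h : CriticalOrbitBounds n E F) (ht : 0 < t)
    (htn : t ≤ n) :
    SettlesWithin (5 * 2 ^ n) (complementPair (5 * 2 ^ n) (2 ^ t)) (E + (n + 1)) := by
  have hlt : 2 ^ t ≤ 2 ^ n := Nat.pow_le_pow_right two_pos htn
  have hpos : 0 < 2 ^ t := by positivity
  have hdvd : ¬ 5 ∣ 2 ^ t := mt Nat.prime_five.dvd_of_dvd_pow (by norm_num)
  exact h.complementPair_even (ht.trans_le htn) (by omega) (Nat.two_pow_mod_two_eq_zero.mpr ht)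
    (by omega)

theorem complementPair_five_mul {a t c : ℕ} (h : CriticalOrbitBounds (a + t) E F) (ht : 0 < t)
    (hc : c % 2 = 1) (hct : c < 2 ^ t) :
    SettlesWithin (5 * 2 ^ (a + t)) (complementPair (5 * 2 ^ (a + t)) (5 * 2 ^ a * c))
      (E + (a + t + 1) + (t + 1)) := by
  have hpos : 0 < 2 ^ a := by positivity
  have horbit := step_iterate_complementPair_mul (C := 5 * 2 ^ a) (by omega) ht hc hct
  rw [mul_assoc 5, ← pow_add] at horbit
  exact (h.complementPair_two_pow ht (by omega)).of_iterate_eq horbit le_rfl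

theorem complementPair_five_mul_add_one {a t c : ℕ} (h : CriticalOrbitBounds (a + t) E F)
    (ht : 0 < t) (hc : c % 2 = 1) (hct : c < 2 ^ t) :
    SettlesWithin (5 * 2 ^ (a + t)) (complementPair (5 * 2 ^ (a + t)) (5 * 2 ^ a * c + 1))
      (E + (a + t + 1) + (t + 1)) := by
  have hpos : 0 < 2 ^ a := by positivity
  have horbit := step_iterate_complementPair_mul_add_one (C := 5 * 2 ^ a) (by omega) ht hc hct
  rw [mul_assoc 5, ← pow_add] at horbit
  exact (h.complementPair_two_pow ht (by omega)).of_iterate_eq horbit le_rfl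

theorem complementPair_of_lt (h : CriticalOrbitBounds n E F) (hn : 0 < n) {w : ℕ} (hw0 : 0 < w)
    (hw : w < 5 * 2 ^ n) :
    SettlesWithin (5 * 2 ^ n) (complementPair (5 * 2 ^ n) w) (E + 2 * (n + 1)) := by
  by_cases hzero : w % 5 = 0
  · obtain ⟨a, t, c, rfl, ht, hc, hct, rfl⟩ :=
      exists_eq_five_mul_two_pow_mul_odd hw0 hw (Nat.dvd_of_mod_eq_zero hzero)
    exact (h.complementPair_five_mul ht hc hct).mono (by omega)
  by_cases hsettle : w % 5 = 2 ∨ w % 5 = 4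
  · exact (settlesWithin_complementPair hw.le hsettle).mono (by omega)
  by_cases hthree : w % 5 = 3
  · exact h.collision.of_iterate_eq
      (step_iterate_complementPair_eq_collisionPair hn hw.le hthree) (by omega)
  rcases Nat.eq_or_lt_of_le hw0 with hone | hone
  · rw [← hone]
    refine (settlesWithin_complementPair (w := 5 * 2 ^ n - 1) (by omega) (by omega)).of_iterate_eq
      (d := 1) (step_zero_right (by omega)) (by omega)
  · obtain ⟨a, t, c, rfl, ht, hc, hct, hwc⟩ :=
      exists_eq_five_mul_two_pow_mul_odd (x := w - 1) (n := n) (by omega) (by omega) (by omega)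
    rw [show w = 5 * 2 ^ a * c + 1 by omega]
    exact (h.complementPair_five_mul_add_one ht hc hct).mono (by omega)

theorem of_fold_iterate_eq {t : ℕ} (h : CriticalOrbitBounds n E F) (hn : 0 < n) (ht : 0 < t)
    (hx : x < 5 * 2 ^ n) (hxy : (fold (5 * 2 ^ n))^[t] x = (fold (5 * 2 ^ n))^[t] y)
    (hx5 : ¬ 5 ∣ x) : SettlesWithin (5 * 2 ^ n) s(x, y) (F + (n + 1) + t) := by
  have hb : 5 ∣ 5 * 2 ^ n := Nat.dvd_mul_right 5 _
  have heven : 5 * 2 ^ n % 2 = 0 := by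
    have := Nat.two_pow_mod_two_eq_zero.mpr hn
    omega
  have hdvd (j : ℕ) : ¬ 5 ∣ (fold (5 * 2 ^ n))^[j] x := by
    rwa [dvd_fold_iterate_iff (by norm_num) hb]
  have hne (j : ℕ) : (fold (5 * 2 ^ n))^[j] x ≠ 5 * 2 ^ n := fun heq => hdvd j (by rwa [heq])
  obtain ⟨j, hj0, hjt, hj⟩ := exists_step_iterate_eq_collisionPair ht hxy (hne t)
  exact (h.collisionPair_even hn ((fold_iterate_le hx.le j).lt_of_ne (hne j))
    (fold_iterate_mod_two heven hj0) (mt Nat.dvd_of_mod_eq_zero (hdvd j))).of_iterate_eq hj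
    (by omega)

theorem of_dvd_of_not_dvd (h : CriticalOrbitBounds n E F) (hx0 : 0 < x) (hx : x < 5 * 2 ^ n)
    (hy : y < 5 * 2 ^ n) (hx5 : 5 ∣ x) (hy5 : ¬ 5 ∣ y) :
    SettlesWithin (5 * 2 ^ n) s(x, y) (E + 2 * (n + 1)) := by
  obtain ⟨a, t, c, rfl, ht, hc, hct, rfl⟩ := exists_eq_five_mul_two_pow_mul_odd hx0 hx hx5
  have hC : 5 ∣ 5 * 2 ^ a := Nat.dvd_mul_right 5 _
  have hb : 5 * 2 ^ (a + t) = 5 * 2 ^ a * 2 ^ t := by ring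
  have horbit := step_iterate_succ_eq_complementPair ht hc hct.le (hb ▸ hy.le)
    (fun hdvd => hy5 (hC.trans hdvd))
  have hfold := fold_iterate_mul_two_pow ht (hb ▸ hy.le)
  rw [← hb] at horbit hfold
  rw [← hfold] at horbit
  have hmod5 : ¬ 5 ∣ (fold (5 * 2 ^ (a + t)))^[t] y := by
    rwa [dvd_fold_iterate_iff (by norm_num) (Nat.dvd_mul_right 5 _)]
  have heven : 5 * 2 ^ (a + t) % 2 = 0 := by
    have := Nat.two_pow_mod_two_eq_zero.mpr (show 0 < a + t by omega)
    omega
  have hlt : (fold (5 * 2 ^ (a + t)))^[t] y < 5 * 2 ^ (a + t) :=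
    (fold_iterate_le hy.le t).lt_of_ne fun h => hmod5 (by rw [h]; exact Nat.dvd_mul_right 5 _)
  refine (h.complementPair_even (by omega) hlt (fold_iterate_mod_two heven ht)
    (by omega)).of_iterate_eq horbit (by omega)

theorem of_not_dvd (h : CriticalOrbitBounds n E F) (hn : 0 < n) (hx : x < 5 * 2 ^ n)
    (hy : y < 5 * 2 ^ n) (hx5 : ¬ 5 ∣ x) (hy5 : ¬ 5 ∣ y) :
    SettlesWithin (5 * 2 ^ n) s(x, y) (F + 2 * (n + 1)) := by
  by_cases hopp : y % 5 = 2 * x % 5 ∨ y % 5 = 3 * x % 5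
  · exact (settlesWithin_of_opposite hx.le hy.le (by omega) hopp).mono (by omega)
  have hsame : y % 5 = x % 5 ∨ x % 5 + y % 5 = 5 := by
    have hres : x % 5 = 1 ∨ x % 5 = 2 ∨ x % 5 = 3 ∨ x % 5 = 4 := by omega
    rcases hres with hres | hres | hres | hres <;> omega
  have hfold : fold 5 (x % 5) = fold 5 (y % 5) := by unfold fold Nat.dist; omega
  refine (h.of_fold_iterate_eq hn n.succ_pos hx ?_ hx5).mono (by omega)
  rw [fold_iterate_succ_mul_two_pow hx.le, fold_iterate_succ_mul_two_pow hy.le, hfold]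

theorem of_valuation_lt {a d t c c' : ℕ} (h : CriticalOrbitBounds (a + d + t) E F) (hd : 0 < d)
    (ht : 0 < t) (hc : c % 2 = 1) (hct : c < 2 ^ t) (hc' : c' % 2 = 1) (hct' : c' < 2 ^ (d + t)) :
    SettlesWithin (5 * 2 ^ (a + d + t)) s(5 * 2 ^ (a + d) * c, 5 * 2 ^ a * c')
      (E + 2 * (a + d + t) + 3) := by
  have hb : 5 * 2 ^ (a + d + t) = 5 * 2 ^ (a + d) * 2 ^ t := by ring
  have hC : 5 * 2 ^ (a + d) = 5 * 2 ^ a * 2 ^ d := by ring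
  have hmod : c' % (2 * 2 ^ d) % 2 = 1 := by rwa [Nat.mod_mul_right_mod]
  have hdist : Nat.dist (5 * 2 ^ (a + d)) (5 * 2 ^ a * c' % (2 * (5 * 2 ^ (a + d)))) * 2 ^ t =
      5 * 2 ^ (a + t) * Nat.dist (2 ^ d) (c' % (2 * 2 ^ d)) := by
    rw [hC, mul_left_comm 2, Nat.mul_mod_mul_left, Nat.dist_mul_left]
    ring
  have heven : 2 ^ d % 2 = 0 := Nat.two_pow_mod_two_eq_zero.mpr hd
  have hlt : c' % (2 * 2 ^ d) < 2 * 2 ^ d := Nat.mod_lt _ (by positivity)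
  have hnot : ¬ 5 * 2 ^ (a + d) ∣ 5 * 2 ^ a * c' := by
    rw [hC, Nat.mul_dvd_mul_iff_left (by positivity)]
    intro hdvd
    have := (dvd_pow_self 2 hd.ne').trans hdvd
    omega
  have horbit := step_iterate_succ_eq_complementPair ht hc hct.le
    (show 5 * 2 ^ a * c' ≤ 5 * 2 ^ (a + d) * 2 ^ t by
      rw [hC, mul_assoc (5 * 2 ^ a), ← pow_add]
      exact Nat.mul_le_mul_left _ hct'.le) hnot
  rw [hdist, ← hb] at horbit
  rw [add_right_comm a d t] at h horbit ⊢
  exact (h.complementPair_five_mul (c := Nat.dist (2 ^ d) (c' % (2 * 2 ^ d))) hd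
    (by unfold Nat.dist; omega) (by unfold Nat.dist; omega)).of_iterate_eq horbit (by omega)

theorem collisionPair_of_fold_iterate_eq_zero {u s : ℕ} (h : CriticalOrbitBounds n E F)
    (hs : 0 < s) (hsn : s ≤ n) (hu : u < 5 * 2 ^ n) (hu0 : 0 < u)
    (hzero : (fold (5 * 2 ^ n))^[s] u = 0) :
    SettlesWithin (5 * 2 ^ n) (collisionPair u) (F + (n + 1) + s) := by
  have hu5 : 5 ∣ u := by
    rw [← dvd_fold_iterate_iff (by norm_num) (Nat.dvd_mul_right 5 (2 ^ n)) s, hzero]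
    exact dvd_zero 5
  have hsub : Nat.dist u 1 = u - 1 := by unfold Nat.dist; omega
  have hneighbours : (fold (5 * 2 ^ n))^[s] (u + 1) = (fold (5 * 2 ^ n))^[s] (u - 1) := by
    obtain ⟨m, rfl⟩ := Nat.exists_eq_add_of_le' hsn
    rw [pow_add, ← mul_assoc] at hu hzero ⊢
    have hpow : 0 < 2 ^ m := by positivity
    exact fold_iterate_add_one_eq_sub_one (by omega) hs hu hzero
  rw [collisionPair, hsub]
  exact h.of_fold_iterate_eq (hs.trans_le hsn) hs (by omega) hneighbours (by omega)

theorem of_valuation_eq {a t c c' : ℕ} (h : CriticalOrbitBounds (a + t) E F) (ht : 0 < t)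
    (hc : c % 2 = 1) (hct : c < 2 ^ t) (hc' : c' % 2 = 1) (hct' : c' < 2 ^ t) :
    SettlesWithin (5 * 2 ^ (a + t)) s(5 * 2 ^ a * c, 5 * 2 ^ a * c') (F + 2 * (a + t + 1)) := by
  have hb : 5 * 2 ^ (a + t) = 5 * 2 ^ a * 2 ^ t := by ring
  have hpos : 0 < 5 * 2 ^ (a + t) := by positivity
  have hx := fold_iterate_mul_of_odd (C := 5 * 2 ^ a) ht hc hct.le
  have hy := fold_iterate_mul_of_odd (C := 5 * 2 ^ a) ht hc' hct'.le
  rw [← hb] at hx hy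
  have hne : (fold (5 * 2 ^ (a + t)))^[t] (5 * 2 ^ a * c) ≠ 5 * 2 ^ (a + t) := by omega
  have hle : 5 * 2 ^ a * c ≤ 5 * 2 ^ (a + t) := hb ▸ Nat.mul_le_mul_left _ hct.le
  obtain ⟨j, hj0, hjt, hj⟩ := exists_step_iterate_eq_collisionPair ht (hx.trans hy.symm) hne
  have hult := (fold_iterate_le hle j).lt_of_ne (fold_iterate_ne_of_le hne hjt)
  rcases Nat.eq_zero_or_pos ((fold (5 * 2 ^ (a + t)))^[j] (5 * 2 ^ a * c)) with hu | hu
  · rw [hu] at hj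
    exact (settlesWithin_one_one (by omega)).of_iterate_eq hj (by omega)
  · have hjt' : j < t := hjt.lt_of_ne (by rintro rfl; omega)
    refine (h.collisionPair_of_fold_iterate_eq_zero (s := t - j) (by omega) (by omega) hult hu
      ?_).of_iterate_eq hj (by omega)
    rwa [← Function.iterate_add_apply, Nat.sub_add_cancel hjt]

theorem of_dvd (h : CriticalOrbitBounds n E F) {M : ℕ} (hE : E + 2 * n + 3 ≤ M)
    (hF : F + 2 * n + 2 ≤ M) (hx0 : 0 < x) (hy0 : 0 < y) (hx : x < 5 * 2 ^ n) (hy : y < 5 * 2 ^ n)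
    (hx5 : 5 ∣ x) (hy5 : 5 ∣ y) : SettlesWithin (5 * 2 ^ n) s(x, y) M := by
  obtain ⟨a, t, c, rfl, ht, hc, hct, rfl⟩ := exists_eq_five_mul_two_pow_mul_odd hx0 hx hx5
  obtain ⟨a', t', c', heq, ht', hc', hct', rfl⟩ := exists_eq_five_mul_two_pow_mul_odd hy0 hy hy5
  rcases lt_trichotomy a a' with hlt | rfl | hlt
  · obtain ⟨d, rfl⟩ := Nat.exists_eq_add_of_lt hlt
    obtain rfl : t = d + 1 + t' := by omega
    rw [heq] at h ⊢
    rw [Sym2.eq_swap]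
    exact (h.of_valuation_lt (d := d + 1) d.succ_pos ht' hc' hct' hc hct).mono (by omega)
  · obtain rfl : t = t' := by omega
    exact (h.of_valuation_eq ht hc hct hc' hct').mono (by omega)
  · obtain ⟨d, rfl⟩ := Nat.exists_eq_add_of_lt hlt
    obtain rfl : t' = d + 1 + t := by omega
    exact (h.of_valuation_lt (d := d + 1) d.succ_pos ht hc hct hc' hct').mono (by omega)

theorem of_zero_right (h : CriticalOrbitBounds n E F) (hn : 0 < n) (hx : x < 5 * 2 ^ n) :
    SettlesWithin (5 * 2 ^ n) s(x, 0) (E + 2 * n + 3) := by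
  rcases Nat.eq_zero_or_pos x with rfl | hx0
  · exact settlesWithin_zero_zero _ _
  · exact (h.complementPair_of_lt hn hx0 hx).of_iterate_eq (d := 1) (step_zero_right hx0)
      (by omega)

theorem settlesWithin (h : CriticalOrbitBounds n E F) (hn : 0 < n) {M : ℕ}
    (hE : E + 2 * n + 3 ≤ M) (hF : F + 2 * n + 2 ≤ M) {p : Sym2 ℕ} (hp : p.sup < 5 * 2 ^ n) :
    SettlesWithin (5 * 2 ^ n) p M := by
  induction p with | _ x y
  obtain ⟨hx, hy⟩ : x < 5 * 2 ^ n ∧ y < 5 * 2 ^ n := sup_lt_iff.mp hp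
  rcases Nat.eq_zero_or_pos x with rfl | hx0
  · rw [Sym2.eq_swap]
    exact (h.of_zero_right hn hy).mono hE
  rcases Nat.eq_zero_or_pos y with rfl | hy0
  · exact (h.of_zero_right hn hx).mono hE
  by_cases hx5 : 5 ∣ x <;> by_cases hy5 : 5 ∣ y
  · exact h.of_dvd hE hF hx0 hy0 hx hy hx5 hy5
  · exact (h.of_dvd_of_not_dvd hx0 hx hy hx5 hy5).mono (by omega)
  · rw [Sym2.eq_swap]
    exact (h.of_dvd_of_not_dvd hy0 hy hx hy5 hx5).mono (by omega)
  · exact (h.of_not_dvd hn hx hy hx5 hy5).mono (by omega)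

end CriticalOrbitBounds

theorem isMaxDistance_of_criticalOrbitBounds {E F M d : ℕ} {p : Sym2 ℕ}
    (h : CriticalOrbitBounds n E F) (hn : 0 < n) (hE : E + n + 2 ≤ d) (hF : F + n + 1 ≤ d)
    (hM : n + d + 2 = M) (hp : p.sup < 5 * 2 ^ n) (horbit : (step (5 * 2 ^ n))^[d] p = s(x, y))
    (hx5 : x % 5 ≠ 0) (hxy : y % 5 = 2 * x % 5 ∨ y % 5 = 3 * x % 5) (hodd : x % 2 = 1) :
    IsMaxDistance (5 * 2 ^ n) M := by
  obtain ⟨hx, hy⟩ : x < 5 * 2 ^ n ∧ y < 5 * 2 ^ n :=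
    sup_lt_iff.mp (show Sym2.sup s(x, y) < _ from horbit ▸ sup_step_iterate_lt hp d)
  subst hM
  refine isMaxDistance_add_two (fun _ hq => h.settlesWithin hn (by omega) (by omega) hq)
    ⟨p, hp, ?_, ?_⟩
  · rw [Nat.add_right_comm, Function.iterate_add_apply, horbit,
      step_iterate_eq_of_opposite hx.le hy.le hx5 hxy]
    exact isNonzeroFixedPair_three_mul (by positivity)
  · rw [Function.iterate_add_apply, horbit]
    exact not_isNonzeroFixedPair_step_iterate_of_odd hn hx hy hx5 hxy hodd

end PowerOfTwo

section OddFactor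

variable {b m n t : ℕ} {p : Sym2 ℕ}

theorem step_eq_map_of_dvd (hm : Odd m) (hm1 : 1 < m) (hb : m ∣ b) (hp : p.sup < b)
    (h0 : p ≠ s(0, 0)) (h : ∀ z ∈ step b p, m ∣ z) :
    (∀ z ∈ p, m ∣ z) ∧ step b p = p.map (fold b) := by
  have hcop : Nat.Coprime m 2 := Nat.coprime_two_right.mpr hm
  obtain ⟨x, y, hyx, rfl⟩ := exists_mk_of_le p
  obtain ⟨hx, -⟩ : x < b ∧ y < b := sup_lt_iff.mp hp
  rw [Ne, Sym2.eq_iff] at h0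
  rcases Nat.eq_zero_or_pos y with rfl | hy
  · rw [step_zero_right (by omega), complementPair, Sym2.ball] at h
    have hpred : m ∣ b - 1 := by
      rw [show b - 1 = b - x + (x - 1) by omega]
      exact dvd_add h.1 h.2
    have hone : m ∣ 1 := (Nat.dvd_sub_iff_right (by omega) hb).mp hpred
    exact absurd (Nat.dvd_one.mp hone) hm1.ne'
  have hx0 : 0 < x := by omega
  by_cases hfold : fold b x = fold b y
  · rw [step_eq_collisionPair hx0 hy hfold, collisionPair, Sym2.ball] at h
    have htwo : m ∣ 2 := by
      rcases Nat.eq_zero_or_pos (fold b x) with hu | hu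
      · rw [hu] at h
        exact h.1.trans (one_dvd 2)
      · rw [show 2 = fold b x + 1 - Nat.dist (fold b x) 1 by unfold Nat.dist; omega]
        exact Nat.dvd_sub h.1 h.2
    exact absurd (hcop.eq_one_of_dvd htwo) hm1.ne'
  · rw [step_eq_map hx0 hy hfold] at h ⊢
    rw [Sym2.ball, dvd_fold_iff hcop hb, dvd_fold_iff hcop hb] at h
    exact ⟨Sym2.ball.mpr h, rfl⟩

theorem step_iterate_eq_map_of_dvd (hm : Odd m) (hm1 : 1 < m) (hb : m ∣ b) (hp : p.sup < b)
    (h0 : (step b)^[t] p ≠ s(0, 0)) (h : ∀ z ∈ (step b)^[t] p, m ∣ z) :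
    (∀ z ∈ p, m ∣ z) ∧ (step b)^[t] p = p.map (fold b)^[t] := by
  induction t generalizing p with
  | zero => exact ⟨h, by simp⟩
  | succ t ih =>
    have hp0 : p ≠ s(0, 0) := by
      rintro rfl
      exact h0 (Function.iterate_fixed (step_zero_zero b) _)
    obtain ⟨hdvd, hiter⟩ := ih (sup_step_lt hp) h0 h
    obtain ⟨hdvd', hstep⟩ := step_eq_map_of_dvd hm hm1 hb hp hp0 hdvd
    rw [Function.iterate_succ_apply, hiter, hstep, Sym2.map_map, ← Function.iterate_succ]
    exact ⟨hdvd', rfl⟩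

theorem fold_iterate_succ_mul {x : ℕ} (hx : x ≤ 5 * 2 ^ n) :
    (fold (5 * m * 2 ^ n))^[n + 1] (x * m) = fold 5 (x % 5) * (m * 2 ^ n) := by
  rw [mul_right_comm, fold_iterate_mul, fold_iterate_succ_mul_two_pow hx, mul_assoc,
    mul_comm (2 ^ n)]

theorem map_fold_iterate_succ_eq_or_isDiag (hp : p.sup < 5 * m * 2 ^ n)
    (hdvd : ∀ z ∈ p, m ∣ z) (hlt : (p.map (fold (5 * m * 2 ^ n))^[n + 1]).sup < 5 * m * 2 ^ n) :
    p.map (fold (5 * m * 2 ^ n))^[n + 1] = s(3 * (m * 2 ^ n), m * 2 ^ n) ∨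
      (p.map (fold (5 * m * 2 ^ n))^[n + 1]).IsDiag := by
  induction p with | _ x y
  obtain ⟨hx, hy⟩ : x < 5 * m * 2 ^ n ∧ y < 5 * m * 2 ^ n := sup_lt_iff.mp hp
  rw [Sym2.ball] at hdvd
  obtain ⟨⟨x, rfl⟩, y, rfl⟩ := hdvd
  rw [mul_comm 5 m, mul_assoc] at hx hy
  rw [Sym2.map_mk, mul_comm m x, mul_comm m y,
    fold_iterate_succ_mul (lt_of_mul_lt_mul_left' hx).le,
    fold_iterate_succ_mul (lt_of_mul_lt_mul_left' hy).le] at hlt ⊢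
  have hodd (z : ℕ) : fold 5 (z % 5) = 1 ∨ fold 5 (z % 5) = 3 ∨ fold 5 (z % 5) = 5 := by
    unfold fold Nat.dist
    omega
  rw [Sym2.sup_mk, sup_lt_iff, mul_assoc 5] at hlt
  rw [Sym2.eq_iff, Sym2.mk_isDiag_iff]
  rcases hodd x with h | h | h <;> rcases hodd y with h' | h' | h' <;>
    rw [h, h'] at hlt ⊢ <;> omega

-- A pair that terminates has an orbit of multiples of `m`, which complements and collisions cannot
-- produce. So the orbit just folds: after `n + 1` steps it has terminated or lies on the diagonal,
-- which folds cannot leave.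
theorem settlesWithin_of_odd_factor (hm : Odd m) (hm1 : 1 < m) (hp : p.sup < 5 * m * 2 ^ n) :
    SettlesWithin (5 * m * 2 ^ n) p (n + 1) := by
  intro j hj
  rcases le_total j (n + 1) with hjn | hjn
  · exact iterate_of_forall_fixed (fun _ h => h.2) hj hjn
  obtain ⟨d, rfl⟩ := Nat.exists_eq_add_of_le' hjn
  have hb : 5 * m * 2 ^ n = 5 * (m * 2 ^ n) := mul_assoc _ _ _
  have hk : 0 < m * 2 ^ n := by positivity
  have hmb : m ∣ 5 * m * 2 ^ n := ⟨5 * 2 ^ n, by ring⟩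
  have hlt := sup_step_iterate_lt hp (n + 1)
  rw [Function.iterate_add_apply] at hj
  have hterminal : (step (5 * m * 2 ^ n))^[d] ((step (5 * m * 2 ^ n))^[n + 1] p) =
      s(3 * (m * 2 ^ n), m * 2 ^ n) := by
    rw [hb] at hj hlt ⊢
    exact hj.eq_three_mul (sup_step_iterate_lt hlt d)
  obtain ⟨hdvd, hlate⟩ := step_iterate_eq_map_of_dvd hm hm1 hmb hlt hj.1 (by
    rw [hterminal, Sym2.ball]
    exact ⟨(Nat.dvd_mul_right m _).mul_left 3, Nat.dvd_mul_right m _⟩)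
  obtain ⟨hdvd, hearly⟩ := step_iterate_eq_map_of_dvd hm hm1 hmb hp (by
    intro heq
    rw [heq, Function.iterate_fixed (step_zero_zero _)] at hj
    exact hj.1 rfl) hdvd
  rw [hterminal, hearly] at hlate
  rw [hearly] at hlt ⊢
  rcases map_fold_iterate_succ_eq_or_isDiag hp hdvd hlt with h | h
  · rw [h, hb]
    exact isNonzeroFixedPair_three_mul hk
  · have hdiag := hlate ▸ h.map
    rw [Sym2.mk_isDiag_iff] at hdiag
    omega

theorem isNonzeroFixedPair_step_iterate_mul (hm : 0 < m) :
    IsNonzeroFixedPair (5 * m * 2 ^ n) ((step (5 * m * 2 ^ n))^[n + 1] s(2 * m, 1 * m)) := by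
  have hpow : 0 < 2 ^ n := by positivity
  have hk : 0 < m * 2 ^ n := by positivity
  have hone : (fold (5 * m * 2 ^ n))^[n + 1] (1 * m) = 3 * (m * 2 ^ n) :=
    fold_iterate_succ_mul (by omega)
  have htwo : (fold (5 * m * 2 ^ n))^[n + 1] (2 * m) = 1 * (m * 2 ^ n) :=
    fold_iterate_succ_mul (by omega)
  have hb : 5 * m * 2 ^ n = 5 * (m * 2 ^ n) := mul_assoc _ _ _
  rw [step_iterate_eq_map (by omega) (by omega) (by omega), hone, htwo, hb, one_mul,
    Sym2.eq_swap]
  exact isNonzeroFixedPair_three_mul hk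

theorem not_isNonzeroFixedPair_step_iterate_mul (hm : 0 < m) :
    ¬ IsNonzeroFixedPair (5 * m * 2 ^ n) ((step (5 * m * 2 ^ n))^[n] s(2 * m, 1 * m)) := by
  intro h
  have hpow : 0 < 2 ^ n := by positivity
  have hk : 0 < m * 2 ^ n := by positivity
  have hb : 5 * m * 2 ^ n = 5 * (m * 2 ^ n) := mul_assoc _ _ _
  have hmk : m ≤ m * 2 ^ n := Nat.le_mul_of_pos_right m hpow
  have hfixed := IsNonzeroFixedPair.eq_three_mul (k := m * 2 ^ n) (hb ▸ sup_step_iterate_lt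
    (sup_lt_iff.mpr (by omega)) n) (hb ▸ h)
  rcases Nat.eq_zero_or_pos n with rfl | hn
  · rw [Function.iterate_zero_apply, Sym2.eq_iff] at hfixed
    omega
  have hone : (fold (5 * m * 2 ^ n))^[n] (1 * m) = 4 * (m * 2 ^ n) := by
    rw [mul_right_comm, fold_iterate_mul, fold_iterate_mul_two_pow hn (by omega), mul_assoc,
      mul_comm (2 ^ n)]
    rfl
  have htwo : (fold (5 * m * 2 ^ n))^[n] (2 * m) = 3 * (m * 2 ^ n) := by
    rw [mul_right_comm, fold_iterate_mul, fold_iterate_mul_two_pow hn (by omega), mul_assoc,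
      mul_comm (2 ^ n)]
    rfl
  rw [← hb, step_iterate_eq_map (by omega) (by omega) (by omega), hone, htwo, Sym2.eq_iff] at hfixed
  omega

theorem isMaxDistance_of_odd_factor (hm : Odd m) (hm1 : 1 < m) :
    IsMaxDistance (5 * m * 2 ^ n) (n + 2) := by
  have hlt : 2 * m < 5 * m * 2 ^ n :=
    (show 2 * m < 5 * m by omega).trans_le (Nat.le_mul_of_pos_right _ (by positivity))
  exact isMaxDistance_add_two (fun p hp => settlesWithin_of_odd_factor hm hm1 hp)
    ⟨s(2 * m, 1 * m), sup_lt_iff.mpr (by omega), isNonzeroFixedPair_step_iterate_mul hm.pos,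
      not_isNonzeroFixedPair_step_iterate_mul hm.pos⟩

end OddFactor

theorem iterate_trans {α : Type*} {f : α → α} {x y z : α} {i j : ℕ} (h : f^[i] x = y)
    (h' : f^[j] y = z) : f^[j + i] x = z := by
  rw [Function.iterate_add_apply, h, h']

section CriticalOrbits

variable {n : ℕ}

theorem step_iterate_half {h d : ℕ} (hh : 0 < h) (hd : 0 < d) :
    (step (2 * h))^[2] s(h + d, h) = complementPair (2 * h) (2 * d) := by
  have hleft : fold (2 * h) (h + d) = 2 * d := by unfold fold Nat.dist; omega
  have hright : fold (2 * h) h = 0 := by unfold fold Nat.dist; omega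
  rw [Function.iterate_succ_apply, Function.iterate_one, step_eq_map (by omega) hh (by omega),
    hleft, hright, step_zero_right (by omega)]

theorem step_iterate_quarter {h d : ℕ} (hd : 0 < d) (hdh : d < h) :
    (step (2 * (2 * h)))^[3] s(h - d, h) = complementPair (2 * (2 * h)) (2 * (2 * d)) := by
  have hleft : fold (2 * (2 * h)) (h - d) = 2 * h + 2 * d := by unfold fold Nat.dist; omega
  have hright : fold (2 * (2 * h)) h = 2 * h := by unfold fold Nat.dist; omega
  rw [Function.iterate_succ_apply, step_eq_map (by omega) (by omega) (by omega), hleft, hright,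
    step_iterate_half (by omega) (by omega)]

theorem step_iterate_half_add_five (hn : 0 < n) :
    (step (5 * 2 ^ (n + 1)))^[n + 3] s(5 * 2 ^ n + 5, 5 * 2 ^ n) =
      complementPair (5 * 2 ^ (n + 1)) (2 ^ n) := by
  have hb : 5 * 2 ^ (n + 1) = 2 * (5 * 2 ^ n) := by ring
  have hb' : 2 * (5 * 2 ^ n) = 10 * 2 ^ n := by ring
  rw [hb]
  refine iterate_trans (i := 2) (j := n + 1) (step_iterate_half (by positivity) (by norm_num)) ?_
  rw [hb']
  exact step_iterate_complementPair_mul (c := 1) (by norm_num) hn rfl (Nat.one_lt_two_pow hn.ne')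

theorem step_iterate_quarter_sub_five (hn : 0 < n) :
    (step (5 * 2 ^ (n + 2)))^[n + 4] s(5 * 2 ^ n - 5, 5 * 2 ^ n) =
      complementPair (5 * 2 ^ (n + 2)) (2 ^ n) := by
  have hlt : 1 < 2 ^ n := Nat.one_lt_two_pow hn.ne'
  have hb : 5 * 2 ^ (n + 2) = 2 * (2 * (5 * 2 ^ n)) := by ring
  have hb' : 2 * (2 * (5 * 2 ^ n)) = 20 * 2 ^ n := by ring
  rw [hb]
  refine iterate_trans (i := 3) (j := n + 1) (step_iterate_quarter (by norm_num) (by omega)) ?_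
  rw [hb']
  exact step_iterate_complementPair_mul (c := 1) (by norm_num) hn rfl hlt

theorem two_pow_mod_five (n : ℕ) : 2 ^ n % 5 = 2 ^ (n % 4) % 5 := by
  conv_lhs => rw [← Nat.div_add_mod n 4, pow_add, pow_mul, Nat.mul_mod, Nat.pow_mod]
  norm_num

theorem isMaxDistance_of_mod_four_eq_zero (hn : 0 < n) (h0 : n % 4 = 0) :
    IsMaxDistance (5 * 2 ^ n) (4 * n + 6) := by
  obtain ⟨m, rfl⟩ := Nat.exists_eq_succ_of_ne_zero hn.ne'
  have hm : 0 < m := by omega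
  have hlt : 1 < 2 ^ m := Nat.one_lt_two_pow hm.ne'
  have heven := Nat.two_pow_mod_two_eq_zero.mpr hn
  have hmod : 2 ^ (m + 1) % 5 = 1 := by rw [two_pow_mod_five, h0]; rfl
  have hmain : SettlesWithin (5 * 2 ^ (m + 1)) s(3 * 2 ^ (m + 1), 2 * 2 ^ (m + 1) - 1) (m + 2) :=
    settlesWithin_of_opposite (by omega) (by omega) (by omega) (by omega)
  have hcollision := step_iterate_collisionPair (u := 2 ^ (m + 1)) hn (by omega) (by omega)
  have hcomplement : SettlesWithin (5 * 2 ^ (m + 1))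
      (complementPair (5 * 2 ^ (m + 1)) (2 ^ (m + 1))) 0 :=
    reachesWithin_of_iterate_add_eq (fun _ h => h.2) (m + 1).succ_pos
      (step_iterate_complementPair_eq_complementPair hn (by omega) (by omega))
  have hcritical : CriticalOrbitBounds (m + 1) (2 * m + 4) (m + 2) :=
    ⟨hmain.of_iterate_eq hcollision (by omega), hcomplement.mono (by omega), hmain⟩
  have hhalf := step_iterate_complementPair_eq_collisionPair (n := m + 1) (w := 2 ^ m) hn
    (by omega) (by omega)
  have horbit := iterate_trans (iterate_trans (step_iterate_half_add_five hm) hhalf) hcollision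
  rw [Sym2.eq_swap (a := 3 * 2 ^ (m + 1))] at horbit
  exact isMaxDistance_of_criticalOrbitBounds hcritical hn (by omega) (by omega) (by omega)
    (sup_lt_iff.mpr (by omega)) horbit (by omega) (by omega) (by omega)

theorem isMaxDistance_of_mod_four_eq_one (hn : 1 < n) (h1 : n % 4 = 1) :
    IsMaxDistance (5 * 2 ^ n) (3 * n + 5) := by
  obtain ⟨m, rfl⟩ := Nat.exists_eq_add_of_le' hn.le
  have hm : 0 < m := by omega
  have hlt : 1 < 2 ^ m := Nat.one_lt_two_pow hm.ne'
  have heven := Nat.two_pow_mod_two_eq_zero.mpr hm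
  have hmod : 2 ^ (m + 1) % 5 = 2 := by rw [two_pow_mod_five, h1]; rfl
  have hcritical : CriticalOrbitBounds (m + 1) (m + 2) (m + 2) :=
    ⟨settlesWithin_collisionPair (by omega) (by omega),
      settlesWithin_complementPair (by omega) (by omega),
      settlesWithin_of_opposite (by omega) (by omega) (by omega) (by omega)⟩
  have hhalf := step_iterate_complementPair_eq_complementPair (n := m + 1) (w := 2 ^ m)
    m.succ_pos (by omega) (by omega)
  have horbit := iterate_trans (step_iterate_half_add_five hm) hhalf
  rw [complementPair, Sym2.eq_swap (b := 2 ^ (m + 1) - 1)] at horbit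
  exact isMaxDistance_of_criticalOrbitBounds hcritical m.succ_pos (by omega) (by omega) (by omega)
    (sup_lt_iff.mpr (by omega)) horbit (by omega) (by omega) (by omega)

theorem isMaxDistance_of_mod_four_eq_two (hn : 2 < n) (h2 : n % 4 = 2) :
    IsMaxDistance (5 * 2 ^ n) (3 * n + 5) := by
  obtain ⟨m, rfl⟩ := Nat.exists_eq_add_of_le' hn.le
  have hm : 0 < m := by omega
  have hn' : 0 < m + 2 := by omega
  have hlt : 1 < 2 ^ m := Nat.one_lt_two_pow hm.ne'
  have heven := Nat.two_pow_mod_two_eq_zero.mpr hm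
  have hfour : 2 ^ (m + 2) = 4 * 2 ^ m := by ring
  have hmod : 2 ^ (m + 2) % 5 = 4 := by rw [two_pow_mod_five, h2]; rfl
  have hcollision := step_iterate_collisionPair (u := 2 ^ (m + 2)) hn' (by omega)
    (by omega)
  have hmain : (step (5 * 2 ^ (m + 2)))^[m + 3] s(3 * 2 ^ (m + 2), 2 * 2 ^ (m + 2) - 1) =
      collisionPair (2 ^ (m + 2)) := by
    have hleft : fold 5 (3 * 2 ^ (m + 2) % 5) = 1 := by unfold fold Nat.dist; omega
    have hright : fold 5 ((2 * 2 ^ (m + 2) - 1) % 5) = 1 := by unfold fold Nat.dist; omega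
    rw [step_iterate_succ_eq_collisionPair hn' (by omega) (by omega) (by omega)
      (hleft.trans hright.symm) (by omega), hleft, one_mul]
  have hloop : (step (5 * 2 ^ (m + 2)))^[m + 3 + (m + 3)] s(3 * 2 ^ (m + 2), 2 * 2 ^ (m + 2) - 1) =
      s(3 * 2 ^ (m + 2), 2 * 2 ^ (m + 2) - 1) := iterate_trans hmain hcollision
  have hcycle : SettlesWithin (5 * 2 ^ (m + 2)) s(3 * 2 ^ (m + 2), 2 * 2 ^ (m + 2) - 1) 0 :=
    reachesWithin_of_iterate_add_eq (fun _ h => h.2) (show 0 < m + 3 + (m + 3) by omega) hloop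
  have hcritical : CriticalOrbitBounds (m + 2) (m + 3) 0 :=
    ⟨hcycle.of_iterate_eq hcollision (by omega),
      settlesWithin_complementPair (by omega) (by omega), hcycle⟩
  have hquarter := step_iterate_complementPair_eq_complementPair (n := m + 2) (w := 2 ^ m)
    hn' (by omega) (by omega)
  have horbit := iterate_trans (step_iterate_quarter_sub_five hm) hquarter
  rw [complementPair, Sym2.eq_swap (b := 2 ^ (m + 2) - 1)] at horbit
  exact isMaxDistance_of_criticalOrbitBounds hcritical hn' (by omega) (by omega)
    (by omega) (sup_lt_iff.mpr (by omega)) horbit (by omega) (by omega) (by omega)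

theorem isMaxDistance_of_mod_four_eq_three (h3 : n % 4 = 3) :
    IsMaxDistance (5 * 2 ^ n) (5 * n + 6) := by
  have hn : 0 < n := by omega
  have hpow : 0 < 2 ^ n := by positivity
  have heven := Nat.two_pow_mod_two_eq_zero.mpr hn
  have hmod : 2 ^ n % 5 = 3 := by rw [two_pow_mod_five, h3]; rfl
  have hcollision : SettlesWithin (5 * 2 ^ n) (collisionPair (2 ^ n)) (n + 1) :=
    settlesWithin_collisionPair (by omega) (by omega)
  have hcomplement := step_iterate_complementPair_eq_collisionPair (w := 2 ^ n) hn (by omega) hmod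
  have hmain : (step (5 * 2 ^ n))^[n + 1] s(3 * 2 ^ n, 2 * 2 ^ n - 1) =
      complementPair (5 * 2 ^ n) (2 ^ n) := by
    obtain ⟨c, hc⟩ := Nat.dvd_of_mod_eq_zero (show (2 * 2 ^ n - 1) % 5 = 0 by omega)
    rw [Sym2.eq_swap, hc]
    exact step_iterate_succ_eq_complementPair_two_pow (by norm_num) hn (by omega) (by omega)
      (by omega) (by omega)
  have hcomplement' := hcollision.of_iterate_eq hcomplement le_rfl
  have hcritical : CriticalOrbitBounds n (2 * n + 2) (3 * n + 3) :=
    ⟨hcollision.mono (by omega), hcomplement'.mono (by omega),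
      hcomplement'.of_iterate_eq hmain (by omega)⟩
  have hstart : (step (5 * 2 ^ n))^[n + 1] s(1, 4) = collisionPair (3 * 2 ^ n) :=
    step_iterate_succ_eq_collisionPair (B := 5) hn (by omega) (by omega) rfl rfl (by decide)
  have hthree := step_iterate_collisionPair (u := 3 * 2 ^ n) hn (by omega) (by omega)
  have horbit := iterate_trans (iterate_trans (iterate_trans hstart hthree) hmain) hcomplement
  rw [collisionPair, Nat.dist_eq_sub_of_le_right (Nat.one_le_two_pow)] at horbit
  exact isMaxDistance_of_criticalOrbitBounds hcritical hn (by omega) (by omega) (by omega)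
    (sup_lt_iff.mpr (by omega)) horbit (by omega) (by omega) (by omega)

end CriticalOrbits

theorem theorem1 :
    (IsMaxDistance 2 1 ∧ IsMaxDistance 4 3 ∧ IsMaxDistance 5 4 ∧ IsMaxDistance 10 7 ∧
      IsMaxDistance 20 10) ∧
    (∀ m n : ℕ, Odd m → 1 < m → IsMaxDistance (5 * m * 2 ^ n) (n + 2)) ∧
    (∀ n : ℕ, 3 ≤ n →
      (n ≡ 0 [MOD 4] → IsMaxDistance (5 * 2 ^ n) (4 * n + 6)) ∧
      (n ≡ 1 [MOD 4] → IsMaxDistance (5 * 2 ^ n) (3 * n + 5)) ∧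
      (n ≡ 2 [MOD 4] → IsMaxDistance (5 * 2 ^ n) (3 * n + 5)) ∧
      (n ≡ 3 [MOD 4] → IsMaxDistance (5 * 2 ^ n) (5 * n + 6))) :=
  ⟨⟨isMaxDistance_two, isMaxDistance_four, isMaxDistance_five, isMaxDistance_ten,
      isMaxDistance_twenty⟩,
    fun _ _ hm hm1 => isMaxDistance_of_odd_factor hm hm1,
    fun _ hn => ⟨isMaxDistance_of_mod_four_eq_zero (by omega),
      isMaxDistance_of_mod_four_eq_one (by omega), isMaxDistance_of_mod_four_eq_two (by omega),
      isMaxDistance_of_mod_four_eq_three⟩⟩
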